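/- **Proposition (no small subgroups of $\mathrm{Aut}_{\bar 0}(\mathcal M)$).** Let $\mathcal M=(M,\mathcal O_{\mathcal M})$ be a compact complex supermanifold of dimension $(m|n)$: $M$ is a compact (second countable Hausdorff) space, not necessarily connected, and $\mathcal O_{\mathcal M}$ is a sheaf of $\mathbb Z/2$-graded complex algebras such that $\mathcal M$ is locally isomorphic to superdomains $(V',\mathcal O_{V'}\otimes\bigwedge\mathbb C^n)$ with $V'\subseteq\mathbb C^m$ open and $\mathcal O_{V'}$ the sheaf of holomorphic functions on $V'$. Let $\mathrm{Aut}_{\bar 0}(\mathcal M)$ be the group, under composition, of the automorphisms of $\mathcal M$, that is, of the invertible morphisms $\varphi=(\tilde\varphi,\varphi^*):\mathcal M\to\mathcal M$, where $\tilde\varphi:M\to M$ is continuous and $\varphi^*:\mathcal O_{\mathcal M}\to\tilde\varphi_*\mathcal O_{\mathcal M}$ is a parity-preserving morphism of sheaves of complex algebras. Endow it with the topology for which the following sets form a subbase: $$\Delta(K,U,f,\theta_j,U_\nu)=\{\varphi\in\mathrm{Aut}_{\bar 0}(\mathcal M)\mid \tilde\varphi(K)\subseteq U,\ \varphi_{f,\nu}(K)\subseteq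 U_\nu\text{ for all }\nu\in(\mathbb Z/2)^n\}.$$ Here $K\subseteq M$ is compact and contained in the domain of a system of local coordinates of $\mathcal M$ with odd coordinates $\theta_1,\dots,\theta_n$, the set $U\subseteq M$ is open, $f\in\mathcal O_{\mathcal M}(U)$, the sets $U_\nu\subseteq\mathbb C$ are open, and $\varphi_{f,\nu}$ are the holomorphic functions near $K$ with $\varphi^*(f)=\sum_\nu\varphi_{f,\nu}\theta^\nu$ in these coordinates. Then $\mathrm{Aut}_{\bar 0}(\mathcal M)$ has no small subgroups: there is a neighbourhood $\Omega$ of the identity in $\mathrm{Aut}_{\bar 0}(\mathcal M)$ such that the only subgroup of $\mathrm{Aut}_{\bar 0}(\mathcal M)$ contained in $\Omega$ is the trivial one. -/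

import Mathlib

open CategoryTheory TopologicalSpace Opposite

universe u

/-! ### The superdomains of complex superdimension `(m|n)` -/

/-- The complex exterior algebra `⋀ ℂⁿ` on the `n` generators `ξ₁, …, ξₙ`. -/
abbrev OddAlgebra (n : ℕ) : Type := ExteriorAlgebra ℂ (Fin n → ℂ)

/-- The basis of `⋀ ℂⁿ` formed by the ordered monomials `ξ^ν`; a multi-index `ν ∈ (ℤ/2)ⁿ` is
encoded as the set of the indices `j` with `ν_j = 1`. -/
noncomputable def oddMonomials (n : ℕ) : Module.Basis (Finset (Fin n)) ℂ (OddAlgebra n) :=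
  (Pi.basisFun ℂ (Fin n)).ExteriorAlgebra

/-- The even (`i = 0`) and the odd (`i = 1`) part of `⋀ ℂⁿ`. -/
def oddAlgebraParity (n : ℕ) (i : ZMod 2) : Submodule ℂ (OddAlgebra n) :=
  CliffordAlgebra.evenOdd (0 : QuadraticForm ℂ (Fin n → ℂ)) i

/-- A function on an open subset `U` of `ℂᵐ` is holomorphic on `U` (its values outside `U`, set to
`0` here, play no role). -/
def IsHolomorphicFun {m : ℕ} (U : Opens (Fin m → ℂ)) (g : U → ℂ) : Prop :=
  DifferentiableOn ℂ (Function.extend Subtype.val g 0) (U : Set (Fin m → ℂ))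

theorem isHolomorphicFun_of_eqOn {m : ℕ} {U : Opens (Fin m → ℂ)} {g : U → ℂ}
    {G : (Fin m → ℂ) → ℂ} (hG : DifferentiableOn ℂ G (U : Set (Fin m → ℂ)))
    (h : ∀ z : U, g z = G z) : IsHolomorphicFun U g := by
  refine DifferentiableOn.congr hG fun z hz => ?_
  have := Subtype.val_injective.extend_apply g 0 (⟨z, hz⟩ : U)
  simpa [h] using this

theorem IsHolomorphicFun.extend_apply {m : ℕ} {U : Opens (Fin m → ℂ)} (g : U → ℂ) (z : U) :
    Function.extend Subtype.val g 0 (z : Fin m → ℂ) = g z :=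
  Subtype.val_injective.extend_apply g 0 z

/-- The superalgebra `𝒪(U) ⊗ ⋀ ℂⁿ` of holomorphic superfunctions `∑_ν f_ν ξ^ν` on an open subset
`U` of `ℂᵐ`: the functions `U → ⋀ ℂⁿ` all of whose coefficients `f_ν` are holomorphic. -/
noncomputable def superFunctions (m n : ℕ) (U : Opens (Fin m → ℂ)) :
    Subalgebra ℂ (U → OddAlgebra n) where
  carrier := {f | ∀ ν, IsHolomorphicFun U fun z => (oddMonomials n).repr (f z) ν}
  algebraMap_mem' r := by
    intro ν
    refine isHolomorphicFun_of_eqOn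
      (differentiableOn_const ((oddMonomials n).repr (algebraMap ℂ (OddAlgebra n) r) ν)) ?_
    intro z
    rfl
  add_mem' {f g} hf hg := by
    intro ν
    refine isHolomorphicFun_of_eqOn ((hf ν).add (hg ν)) ?_
    intro z
    simp
  mul_mem' {f g} hf hg := by
    intro ν
    refine isHolomorphicFun_of_eqOn
      (G := fun z => ∑ κ, ∑ μ,
        (Function.extend Subtype.val (fun z : U => (oddMonomials n).repr (f z) κ) 0 z *
          Function.extend Subtype.val (fun z : U => (oddMonomials n).repr (g z) μ) 0 z) *
          (oddMonomials n).repr (oddMonomials n κ * oddMonomials n μ) ν) ?_ ?_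
    · exact DifferentiableOn.fun_sum fun κ _ => DifferentiableOn.fun_sum fun μ _ =>
        ((hf κ).mul (hg μ)).mul_const _
    · intro z
      simp only [IsHolomorphicFun.extend_apply, Pi.mul_apply]
      conv_lhs =>
        rw [← (oddMonomials n).sum_repr (f z), ← (oddMonomials n).sum_repr (g z),
          Finset.sum_mul_sum]
      simp only [smul_mul_smul_comm, map_sum, map_smul, Finsupp.coe_finsetSum, Finset.sum_apply,
        Finsupp.smul_apply, smul_eq_mul]

/-- Restriction of superfunctions to a smaller open set. -/
noncomputable def superFunctionsRes (m n : ℕ) {V U : Opens (Fin m → ℂ)} (h : V ≤ U) :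
    superFunctions m n U →ₐ[ℂ] superFunctions m n V where
  toFun f := ⟨fun z => f.1 ⟨z, h z.2⟩, fun ν =>
    isHolomorphicFun_of_eqOn ((f.2 ν).mono h) fun z =>
      (IsHolomorphicFun.extend_apply (fun z : U => (oddMonomials n).repr (f.1 z) ν)
        ⟨z, h z.2⟩).symm⟩
  map_one' := rfl
  map_mul' _ _ := rfl
  map_zero' := rfl
  map_add' _ _ := rfl
  commutes' _ := rfl

/-! ### Superspaces and their morphisms -/

/-- A (complex) superspace: a topological space with a sheaf of unital associative
`ℤ/2`-graded complex algebras. -/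
structure Superspace where
  /-- The underlying space with its structure sheaf of complex algebras. -/
  space : AlgebraicGeometry.SheafedSpace.{u + 1, u, u} (AlgCat.{u} ℂ)
  /-- The even (`i = 0`) and odd (`i = 1`) sections over an open set. -/
  parity : ∀ U : Opens space, ZMod 2 → Submodule ℂ (space.presheaf.obj (op U))
  parity_gradedMonoid : ∀ U, SetLike.GradedMonoid (parity U)
  parity_isInternal : ∀ U, DirectSum.IsInternal (parity U)
  map_parity : ∀ {U V : Opens space} (h : V ≤ U) (i : ZMod 2),
    ∀ s ∈ parity U i, (space.presheaf.map (homOfLE h).op).hom s ∈ parity V i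

namespace Superspace

/-- The algebra `𝒪(U)` of sections of the structure sheaf over `U`. -/
abbrev sections (X : Superspace.{u}) (U : Opens X.space) : AlgCat.{u} ℂ :=
  X.space.presheaf.obj (op U)

/-- The restriction `𝒪(U) → 𝒪(V)` for `V ⊆ U`. -/
def res (X : Superspace.{u}) {V U : Opens X.space} (h : V ≤ U) :
    X.sections U →ₐ[ℂ] X.sections V :=
  (X.space.presheaf.map (homOfLE h).op).hom

/-- A morphism of superspaces: a continuous map `φ̃ : X → Y` with a parity-preserving morphism of
sheaves of complex algebras `φ^* : 𝒪_Y → φ̃_* 𝒪_X`. -/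
@[ext]
structure Hom (X Y : Superspace.{u}) where
  /-- The underlying morphism of spaces with a sheaf of complex algebras. -/
  toHom : X.space ⟶ Y.space
  map_parity : ∀ (U : Opens Y.space) (i : ZMod 2), ∀ s ∈ Y.parity U i,
    (toHom.hom.c.app (op U)).hom s ∈ X.parity ((Opens.map toHom.hom.base).obj U) i

instance : Category Superspace.{u} where
  Hom := Hom
  id X := ⟨𝟙 X.space, fun _ _ _ hs => hs⟩
  comp f g := ⟨f.toHom ≫ g.toHom, fun U i s hs => f.map_parity _ i _ (g.map_parity U i s hs)⟩

/-- The underlying continuous map `φ̃` of a morphism `φ`. -/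
def Hom.base {X Y : Superspace.{u}} (φ : X ⟶ Y) : C(X.space, Y.space) :=
  (Hom.toHom φ).hom.base.hom

/-- The open set `φ̃⁻¹(U)`. -/
abbrev Hom.preimage {X Y : Superspace.{u}} (φ : X ⟶ Y) (U : Opens Y.space) : Opens X.space :=
  (Opens.map (Hom.toHom φ).hom.base).obj U

/-- The pullback `φ^* : 𝒪_Y(U) → 𝒪_X(φ̃⁻¹(U))` of a morphism `φ`. -/
def Hom.pullback {X Y : Superspace.{u}} (φ : X ⟶ Y) (U : Opens Y.space) :
    Y.sections U →ₐ[ℂ] X.sections (Hom.preimage φ U) :=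
  ((Hom.toHom φ).hom.c.app (op U)).hom

end Superspace

/-! ### Complex supermanifolds -/

/-- The image of an open subset of the domain of a local homeomorphism, as an open set. -/
def imageOpens {X E : Type*} [TopologicalSpace X] [TopologicalSpace E]
    (e : OpenPartialHomeomorph X E) (W : Opens X) (hW : (W : Set X) ⊆ e.source) : Opens E :=
  ⟨e '' W, e.isOpen_image_of_subset_source W.2 hW⟩

theorem imageOpens_mono {X E : Type*} [TopologicalSpace X] [TopologicalSpace E]
    (e : OpenPartialHomeomorph X E) {V W : Opens X} (h : V ≤ W)
    (hW : (W : Set X) ⊆ e.source) :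
    imageOpens e V (Set.Subset.trans h hW) ≤ imageOpens e W hW :=
  Set.image_mono h

/-- A superchart of `X` of dimension `(m|n)`: an isomorphism between an open part
`(V, 𝒪_X|_V)` of the superspace `X` and a superdomain `(V', 𝒪_{V'} ⊗ ⋀ ℂⁿ)`, `V' ⊆ ℂᵐ` open.
It is the same thing as a system of local coordinates `z₁, …, zₘ, ξ₁, …, ξₙ` on `V`. -/
structure SuperChart (X : Superspace.{u}) (m n : ℕ) where
  /-- The underlying homeomorphism of `V` onto `V'`. -/
  homeo : OpenPartialHomeomorph X.space (Fin m → ℂ)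
  /-- The isomorphism of the structure sheaves. -/
  iso : ∀ (W : Opens X.space) (hW : (W : Set X.space) ⊆ homeo.source),
    X.sections W ≃ₐ[ℂ] superFunctions m n (imageOpens homeo W hW)
  iso_res : ∀ {V W : Opens X.space} (h : V ≤ W) (hW : (W : Set X.space) ⊆ homeo.source)
    (s : X.sections W),
    iso V (Set.Subset.trans h hW) (X.res h s) =
      superFunctionsRes m n (imageOpens_mono homeo h hW) (iso W hW s)
  iso_parity : ∀ (W : Opens X.space) (hW : (W : Set X.space) ⊆ homeo.source) (i : ZMod 2)
    (s : X.sections W),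
    s ∈ X.parity W i ↔ ∀ z, (iso W hW s).1 z ∈ oddAlgebraParity n i

namespace SuperChart

variable {X : Superspace.{u}} {m n : ℕ}

/-- The domain of a superchart. -/
def source (c : SuperChart X m n) : Opens X.space := ⟨c.homeo.source, c.homeo.open_source⟩

/-- The coefficient function `f_ν` in the expansion `f = ∑_ν f_ν ξ^ν` of a section `f` over an
open subset `W` of the domain of a superchart, as a function of the points of `W`. -/
noncomputable def coeff (c : SuperChart X m n) {W : Opens X.space} (hW : W ≤ c.source)
    (f : X.sections W) (ν : Finset (Fin n)) (x : W) : ℂ :=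
  (oddMonomials n).repr ((c.iso W hW f).1 ⟨c.homeo x, x, x.2, rfl⟩) ν

end SuperChart

/-- A complex supermanifold of dimension `(m|n)`: a superspace whose underlying space is Hausdorff
and second countable and which is locally isomorphic to superdomains of dimension `(m|n)`.
The supercharts induce the structure of a complex manifold on the underlying space. -/
structure ComplexSupermanifold (m n : ℕ) where
  /-- The superspace. -/
  toSuperspace : Superspace.{u}
  t2Space : T2Space toSuperspace.space
  secondCountable : SecondCountableTopology toSuperspace.space
  exists_chart : ∀ x : toSuperspace.space,
    ∃ c : SuperChart toSuperspace m n, x ∈ c.source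

namespace ComplexSupermanifold

variable {m n : ℕ}

/-- A supermanifold is compact if its underlying manifold is. -/
def IsCompactSupermanifold (M : ComplexSupermanifold.{u} m n) : Prop :=
  CompactSpace M.toSuperspace.space

/-- The automorphisms of a complex supermanifold `M`, i.e. the invertible morphisms `M → M`. -/
def AutZero (M : ComplexSupermanifold.{u} m n) : Type u := Aut M.toSuperspace

/-- The group structure: composition of automorphisms. -/
noncomputable instance (M : ComplexSupermanifold.{u} m n) : Group M.AutZero :=
  inferInstanceAs (Group (Aut M.toSuperspace))

/-- The morphism `M → M` underlying an automorphism. -/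
def AutZero.toMorphism {M : ComplexSupermanifold.{u} m n} (φ : M.AutZero) :
    M.toSuperspace ⟶ M.toSuperspace :=
  Iso.hom (X := M.toSuperspace) (Y := M.toSuperspace) φ

/-- The section `φ^* f`, restricted to the part of `φ̃⁻¹(U)` in the domain of a superchart. -/
def AutZero.localPullback {M : ComplexSupermanifold.{u} m n} (φ : M.AutZero)
    (c : SuperChart M.toSuperspace m n) {U : Opens M.toSuperspace.space}
    (f : M.toSuperspace.sections U) :
    M.toSuperspace.sections (Superspace.Hom.preimage φ.toMorphism U ⊓ c.source) :=
  M.toSuperspace.res inf_le_left (Superspace.Hom.pullback φ.toMorphism U f)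

/-- The set `Δ(K, U, f, θ_j, U_ν)` of the automorphisms `φ` with `φ̃(K) ⊆ U` and
`φ_{f,ν}(K) ⊆ U_ν` for all `ν`, where `φ^* f = ∑_ν φ_{f,ν} θ^ν` near `K` in the local coordinates
given by the superchart `c`. It is used for `K` contained in the domain of `c`. -/
def subbasicSet (M : ComplexSupermanifold.{u} m n) (c : SuperChart M.toSuperspace m n)
    (K : Set M.toSuperspace.space) (U : Opens M.toSuperspace.space)
    (f : M.toSuperspace.sections U) (O : Finset (Fin n) → Set ℂ) : Set M.AutZero :=
  {φ | Set.MapsTo (Superspace.Hom.base φ.toMorphism) K U ∧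
    ∀ (ν : Finset (Fin n))
      (x : (Superspace.Hom.preimage φ.toMorphism U ⊓ c.source : Opens M.toSuperspace.space)),
      (x : M.toSuperspace.space) ∈ K →
        c.coeff inf_le_right (φ.localPullback c f) ν x ∈ O ν}

/-- The topology on the group of automorphisms generated by the sets `Δ(K, U, f, θ_j, U_ν)` with
`K` compact and contained in a coordinate domain, `U` open, `f ∈ 𝒪(U)` and all `U_ν` open. -/
instance (M : ComplexSupermanifold.{u} m n) : TopologicalSpace M.AutZero :=
  TopologicalSpace.generateFrom
    {S | ∃ (c : SuperChart M.toSuperspace m n) (K : Set M.toSuperspace.space)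
      (U : Opens M.toSuperspace.space) (f : M.toSuperspace.sections U)
      (O : Finset (Fin n) → Set ℂ),
      IsCompact K ∧ K ⊆ c.source ∧ (∀ ν, IsOpen (O ν)) ∧ S = M.subbasicSet c K U f O}

end ComplexSupermanifold

/-!
Let `Q` be a group of automorphisms contained in a small neighbourhood of the identity. Everything
happens in a superchart `c` around a point, and finitely many charts suffice by compactness
(`ComplexSupermanifold.exists_nhds_one_forall_trivial_near` is the local result).

*Points.* The map `F` underlying `φ ∈ Q` is holomorphic in coordinates and close to the identity on
a ball. By the Schwarz lemma `F - id` is Lipschitz with constant `1 / 2` on a smaller scale, so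
`|F (F z) - z| ≥ 3 / 2 * |F z - z|` (`norm_apply_apply_sub_self_ge`). As all `φ ^ (2 ^ k)` belong
to `Q`, they move `z` by a bounded amount, and `F z = z`
(`ComplexSupermanifold.AutZero.base_eq_self_of_forall_dist_le`).

*Coordinates.* Now `φ^*` is, in coordinates, an algebra endomorphism `τ` of `𝒪 ⊗ ⋀ ℂⁿ` that
preserves bodies, hence the powers of the ideal `J` generated by the odd coordinates. On `J / J²` it
acts by a matrix, all of whose powers are close to `1`; the same doubling argument shows that the
matrix is `1` (`oddJacobian_eq_one`). Therefore `τ - 1` maps `J^l` to `J^(l+1)` and is nilpotent, and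
the coefficients of `τ^s u` at a point are polynomials in `s`. If `u` is a coordinate, they are
bounded, hence constant, and `τ u = u` (`apply_coord_eq_self`).

*All sections.* If `τ` fixes the coordinates, then `τ f` and `f` have the same value at any point `x`:
dividing a holomorphic function of `z_1, …, z_m` by `z_i - x_i`, with a holomorphic quotient
(`exists_differentiableOn_eq_update_add_mul`), reduces this to functions independent of `z_i`, one
`i` after the other (`apply_apply_center`). A superfunction is determined by its values in `⋀ ℂⁿ`,
so that `φ^*` is the identity.
-/

/-! ### The exterior algebra: generators, body and filtration -/

/-- The generator `ξ_j` of `⋀ ℂⁿ`. -/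
noncomputable def oddGen (n : ℕ) (j : Fin n) : OddAlgebra n :=
  ExteriorAlgebra.ι ℂ (Pi.single j 1)

theorem exists_list_prod_eq_oddMonomials {n : ℕ} (ν : Finset (Fin n)) :
    ∃ L : List (Fin n), L.length = ν.card ∧ (∀ j ∈ L, j ∈ ν) ∧
      (L.map (oddGen n)).prod = oddMonomials n ν := by
  refine ⟨List.ofFn (ν.orderEmbOfFin rfl), by simp, by simp [List.mem_ofFn], ?_⟩
  rw [oddMonomials, ExteriorAlgebra.basis_apply_ofCard _ rfl]
  refine Eq.trans ?_ (ExteriorAlgebra.ιMulti_apply _).symm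
  rw [List.map_ofFn]
  congr 2
  funext i
  simp [oddGen]
  rfl

theorem oddMonomials_empty (n : ℕ) : oddMonomials n ∅ = 1 := by
  obtain ⟨L, hL, -, h⟩ := exists_list_prod_eq_oddMonomials (∅ : Finset (Fin n))
  obtain rfl := List.length_eq_zero_iff.1 (hL.trans Finset.card_empty)
  simpa using h.symm

theorem oddMonomials_singleton {n : ℕ} (j : Fin n) : oddMonomials n {j} = oddGen n j := by
  obtain ⟨L, hL, hmem, h⟩ := exists_list_prod_eq_oddMonomials {j}
  obtain ⟨i, rfl⟩ := List.length_eq_one_iff.1 (hL.trans (Finset.card_singleton j))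
  rw [← h, Finset.mem_singleton.1 (hmem i (by simp))]
  simp

/-- The body map `⋀ ℂⁿ → ℂ`, which kills the generators `ξ_j`. -/
noncomputable def oddBody (n : ℕ) : OddAlgebra n →ₐ[ℂ] ℂ := ExteriorAlgebra.algebraMapInv

theorem oddBody_oddMonomials {n : ℕ} (ν : Finset (Fin n)) :
    oddBody n (oddMonomials n ν) = if ν = ∅ then 1 else 0 := by
  obtain ⟨L, hL, -, h⟩ := exists_list_prod_eq_oddMonomials ν
  rw [← h]
  split_ifs with h0
  · subst h0
    obtain rfl := List.length_eq_zero_iff.1 (hL.trans Finset.card_empty)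
    simp
  · cases L with
    | nil => simp at hL; exact absurd hL.symm (by simpa using h0)
    | cons j L => simp [oddBody, oddGen, ExteriorAlgebra.algebraMapInv]

theorem oddMonomials_repr_empty {n : ℕ} (x : OddAlgebra n) :
    (oddMonomials n).repr x ∅ = oddBody n x := by
  suffices (oddMonomials n).coord ∅ = (oddBody n).toLinearMap from congr($this x)
  refine (oddMonomials n).ext fun ν => ?_
  simp [oddBody_oddMonomials, Finsupp.single_apply]

/-- The elements of `⋀ ℂⁿ` all of whose terms have degree at least `l`. -/
noncomputable def oddFiltration (n l : ℕ) : Submodule ℂ (OddAlgebra n) where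
  carrier := {x | ∀ ν : Finset (Fin n), ν.card < l → (oddMonomials n).repr x ν = 0}
  add_mem' hx hy ν hν := by simp [hx ν hν, hy ν hν]
  zero_mem' ν _ := by simp
  smul_mem' a x hx ν hν := by simp [hx ν hν]

theorem oddMonomials_mem_oddFiltration {n l : ℕ} {ν : Finset (Fin n)} (h : l ≤ ν.card) :
    oddMonomials n ν ∈ oddFiltration n l := by
  intro μ hμ
  rw [Module.Basis.repr_self, Finsupp.single_apply, if_neg]
  rintro rfl
  omega

theorem oddFiltration_anti {n k l : ℕ} (h : k ≤ l) : oddFiltration n l ≤ oddFiltration n k :=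
  fun _ hx ν hν => hx ν (hν.trans_le h)

theorem mem_oddFiltration_zero {n : ℕ} (x : OddAlgebra n) : x ∈ oddFiltration n 0 :=
  fun _ hν => absurd hν (Nat.not_lt_zero _)

theorem eq_zero_of_mem_oddFiltration {n : ℕ} {x : OddAlgebra n} (hx : x ∈ oddFiltration n (n + 1)) :
    x = 0 := by
  refine (oddMonomials n).ext_elem fun ν => ?_
  rw [hx ν, map_zero, Finsupp.zero_apply]
  have := Finset.card_le_univ ν
  rw [Fintype.card_fin] at this
  omega

theorem mem_oddFiltration_one {n : ℕ} {x : OddAlgebra n} :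
    x ∈ oddFiltration n 1 ↔ oddBody n x = 0 := by
  rw [← oddMonomials_repr_empty]
  refine ⟨fun h => h ∅ (by simp), fun h ν hν => ?_⟩
  rw [Nat.lt_one_iff, Finset.card_eq_zero] at hν
  rwa [hν]

theorem oddGen_mem_oddFiltration {n : ℕ} (j : Fin n) : oddGen n j ∈ oddFiltration n 1 :=
  oddMonomials_singleton j ▸ oddMonomials_mem_oddFiltration (by simp)

theorem oddMonomials_mul_mem_oddFiltration {n : ℕ} (ν μ : Finset (Fin n)) :
    oddMonomials n ν * oddMonomials n μ ∈ oddFiltration n (ν.card + μ.card) := by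
  by_cases h : Disjoint ν μ
  · have := ExteriorAlgebra.basis_mul_of_disjoint (Pi.basisFun ℂ (Fin n))
      (⟨ν, rfl⟩ : Set.powersetCard (Fin n) ν.card) ⟨μ, rfl⟩ h
    rw [oddMonomials, this, Units.smul_def]
    refine (oddFiltration n _).toAddSubgroup.zsmul_mem (oddMonomials_mem_oddFiltration ?_) _
    exact (Set.powersetCard.disjUnion h).2.ge
  · have := ExteriorAlgebra.basis_mul_of_not_disjoint (Pi.basisFun ℂ (Fin n))
      (⟨ν, rfl⟩ : Set.powersetCard (Fin n) ν.card) ⟨μ, rfl⟩ h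
    rw [oddMonomials, this]
    exact zero_mem _

theorem mul_mem_oddFiltration {n k l : ℕ} {x y : OddAlgebra n} (hx : x ∈ oddFiltration n k)
    (hy : y ∈ oddFiltration n l) : x * y ∈ oddFiltration n (k + l) := by
  rw [← (oddMonomials n).sum_repr x, ← (oddMonomials n).sum_repr y, Finset.sum_mul_sum]
  refine sum_mem fun ν _ => sum_mem fun μ _ => ?_
  rw [smul_mul_smul_comm]
  by_cases hν : ν.card < k
  · simp [hx ν hν]
  by_cases hμ : μ.card < l
  · simp [hy μ hμ]
  exact Submodule.smul_mem _ _ (oddFiltration_anti (by omega)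
    (oddMonomials_mul_mem_oddFiltration ν μ))

theorem pow_mem_oddFiltration {n : ℕ} {x : OddAlgebra n} (hx : x ∈ oddFiltration n 1) (k : ℕ) :
    x ^ k ∈ oddFiltration n k := by
  induction k with
  | zero => exact mem_oddFiltration_zero _
  | succ k ih => exact pow_succ x k ▸ mul_mem_oddFiltration ih hx

/-! ### Bounded sequences and powers -/

/-- A sequence that grows at least geometrically and is bounded starts at `0`. -/
theorem eq_zero_of_geometric_growth {d : ℕ → ℝ} {C : ℝ} (h0 : 0 ≤ d 0)
    (hd : ∀ k, 3 / 2 * d k ≤ d (k + 1)) (hC : ∀ k, d k ≤ C) : d 0 = 0 := by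
  have key : ∀ k, (3 / 2 : ℝ) ^ k * d 0 ≤ d k := by
    intro k
    induction k with
    | zero => simp
    | succ k ih =>
      calc (3 / 2 : ℝ) ^ (k + 1) * d 0 = 3 / 2 * ((3 / 2) ^ k * d 0) := by ring
        _ ≤ 3 / 2 * d k := by linarith
        _ ≤ d (k + 1) := hd k
  by_contra hne
  have hpos : 0 < d 0 := lt_of_le_of_ne h0 (Ne.symm hne)
  obtain ⟨k, hk⟩ := pow_unbounded_of_one_lt (C / d 0) (by norm_num : (1 : ℝ) < 3 / 2)
  rw [div_lt_iff₀ hpos] at hk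
  exact absurd ((key k).trans (hC k)) (not_le.2 hk)

/-- If all powers of `a` are close to `1`, then `a = 1`: the distance of `a` to `1` is multiplied by
at least `3 / 2` when `a` is squared. -/
theorem eq_one_of_forall_norm_pow_sub_one_le {R : Type*} [NormedRing R] [NormedSpace ℝ R] {a : R}
    (h : ∀ s : ℕ, ‖a ^ s - 1‖ ≤ 1 / 2) : a = 1 := by
  have := eq_zero_of_geometric_growth (d := fun k => ‖a ^ 2 ^ k - 1‖) (C := 1 / 2) (norm_nonneg _)
    (fun k => ?_) (fun k => h _)
  · simpa [sub_eq_zero] using this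
  set b := a ^ 2 ^ k
  have hb : ‖b - 1‖ ≤ 1 / 2 := h _
  have e : a ^ 2 ^ (k + 1) - 1 = (2 : ℝ) • (b - 1) + (b - 1) * (b - 1) := by
    rw [pow_succ, pow_mul, two_smul]
    change b ^ 2 - 1 = _
    noncomm_ring
  have h1 : ‖(2 : ℝ) • (b - 1)‖ = 2 * ‖b - 1‖ := by rw [norm_smul]; norm_num
  have h2 : ‖(b - 1) * (b - 1)‖ ≤ ‖b - 1‖ * (1 / 2) :=
    (norm_mul_le _ _).trans (by gcongr)
  have h3 := norm_sub_le_norm_add ((2 : ℝ) • (b - 1)) ((b - 1) * (b - 1))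
  change 3 / 2 * ‖b - 1‖ ≤ ‖a ^ 2 ^ (k + 1) - 1‖
  rw [e]
  linarith

/-- A bounded orbit of a unipotent operator is constant: along `s`, the vector `τ ^ s u` is a
polynomial in `s`. Boundedness is tested by a separating family of functionals. -/
theorem apply_eq_self_of_unipotent_of_bounded {V ι : Type*} [AddCommGroup V] [Module ℂ V]
    (τ : Module.End ℂ V) (ℓ : ι → V →ₗ[ℂ] ℂ) (hℓ : ∀ v, (∀ i, ℓ i v = 0) → v = 0) (k : ℕ) (u : V)
    (hu : ((τ - 1) ^ (k + 1)) u = 0) (hb : ∀ i, ∃ C, ∀ s : ℕ, ‖ℓ i ((τ ^ s) u)‖ ≤ C) :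
    τ u = u := by
  induction k generalizing u with
  | zero => simpa [sub_eq_zero] using hu
  | succ k ih =>
    have hN : (τ - 1) (τ u - u) = 0 := by
      have h := ih (τ u - u) ?_ fun i => ?_
      · rw [LinearMap.sub_apply, h]
        simp
      · rw [pow_succ] at hu
        simpa using hu
      · obtain ⟨C, hC⟩ := hb i
        refine ⟨C + C, fun s => ?_⟩
        have := (norm_sub_le (ℓ i ((τ ^ (s + 1)) u)) (ℓ i ((τ ^ s) u))).trans
          (add_le_add (hC _) (hC _))
        rwa [← map_sub, pow_succ, Module.End.mul_apply, ← map_sub] at this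
    set v := τ u - u
    have hv : τ v = v := by simpa [sub_eq_zero] using hN
    have hs : ∀ s : ℕ, (τ ^ s) u = u + (s : ℂ) • v := by
      intro s
      induction s with
      | zero => simp
      | succ s ihs =>
        rw [pow_succ', Module.End.mul_apply, ihs, map_add, map_smul, hv]
        have : τ u = u + v := by simp [v]
        rw [this]
        push_cast
        module
    refine sub_eq_zero.1 (hℓ v fun i => ?_)
    obtain ⟨C, hC⟩ := hb i
    by_contra hne
    have hpos : 0 < ‖ℓ i v‖ := norm_pos_iff.2 hne
    obtain ⟨s, hs'⟩ := exists_nat_gt ((C + ‖ℓ i u‖) / ‖ℓ i v‖)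
    rw [div_lt_iff₀ hpos] at hs'
    have h1 := hC s
    rw [hs, map_add, map_smul, smul_eq_mul] at h1
    have h2 := norm_sub_le_norm_add ((s : ℂ) * ℓ i v) (ℓ i u)
    rw [norm_mul, Complex.norm_natCast, add_comm ((s : ℂ) * ℓ i v)] at h2
    linarith

/-! ### Holomorphic maps close to the identity -/

open Metric in
/-- A holomorphic map that moves the points of a ball by little moves the points of the concentric
ball of half the radius, when applied twice, by at least `3 / 2` times as much as when applied
once: by the Schwarz lemma, its difference to the identity is Lipschitz with constant `1 / 2`. -/
theorem norm_apply_apply_sub_self_ge {E : Type*} [NormedAddCommGroup E] [NormedSpace ℂ E]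
    {F : E → E} {p : E} {r : ℝ} (hF : DifferentiableOn ℂ F (ball p (2 * r)))
    (h : ∀ z ∈ ball p (2 * r), ‖F z - z‖ ≤ r / 4) {z : E} (hz : z ∈ ball p r) :
    3 / 2 * ‖F z - z‖ ≤ ‖F (F z) - z‖ := by
  have hr : 0 < r := dist_nonneg.trans_lt hz
  have hsub : ball z r ⊆ ball p (2 * r) := ball_subset_ball' (by rw [mem_ball] at hz; linarith)
  have hz' : z ∈ ball p (2 * r) := hsub (mem_ball_self hr)
  have hFz : F z ∈ ball z r := by
    rw [mem_ball, dist_eq_norm]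
    linarith [h z hz']
  have hlip := Complex.dist_le_div_mul_dist_of_mapsTo_ball (f := fun w => F w - w) (R₂ := r / 2)
    ((hF.mono hsub).sub differentiableOn_id) (fun w hw => by
      rw [mem_closedBall, dist_eq_norm]
      have := norm_sub_le (F w - w) (F z - z)
      linarith [h w (hsub hw), h z hz']) hFz
  rw [dist_eq_norm, dist_eq_norm, div_div, mul_comm (2 : ℝ), ← div_div, div_self hr.ne'] at hlip
  have e : F (F z) - z = (F z - z) + (F z - z) + ((F (F z) - F z) - (F z - z)) := by abel
  have h1 := norm_sub_le_norm_add ((F z - z) + (F z - z)) ((F (F z) - F z) - (F z - z))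
  rw [← e, ← two_smul ℝ, norm_smul] at h1
  norm_num at h1
  linarith

/-! ### Division by a coordinate function -/

open Metric Topology MeasureTheory in
/-- A circle integral of a holomorphic function depends holomorphically on parameters. -/
theorem differentiableAt_circleIntegral_of_differentiableOn {E : Type*} [NormedAddCommGroup E]
    [NormedSpace ℂ E] [FiniteDimensional ℂ E] {G : E × ℂ → ℂ} {Ω : Set (E × ℂ)} (hΩ : IsOpen Ω)
    (hG : DifferentiableOn ℂ G Ω) {z₀ : E} {c : ℂ} {ρ : ℝ} (hρ : 0 ≤ ρ)
    (h : ∀ ζ ∈ sphere c ρ, (z₀, ζ) ∈ Ω) :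
    DifferentiableAt ℂ (fun z => ∮ ζ in C(c, ρ), G (z, ζ)) z₀ := by
  have : ProperSpace E := FiniteDimensional.proper ℂ E
  obtain ⟨u, v, hu, -, hzu, hcv, huv⟩ := generalized_tube_lemma (isCompact_singleton (x := z₀))
    (isCompact_sphere c ρ) hΩ (by
      rintro ⟨z, ζ⟩ ⟨rfl, hζ⟩
      exact h ζ hζ)
  obtain ⟨δ, hδ, hδu⟩ := nhds_basis_closedBall.mem_iff.1 (hu.mem_nhds (hzu rfl))
  have hK : closedBall z₀ δ ×ˢ sphere c ρ ⊆ Ω := (Set.prod_mono hδu hcv).trans huv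
  obtain ⟨M, hM⟩ :=
    ((isCompact_closedBall z₀ δ).prod (isCompact_sphere c ρ)).exists_bound_of_continuousOn
      (hG.continuousOn.mono hK)
  have hcm : ∀ θ, circleMap c ρ θ ∈ sphere c ρ := fun θ => circleMap_mem_sphere c hρ θ
  have hdiff : ∀ z ∈ closedBall z₀ δ, ∀ θ, DifferentiableAt ℂ G (z, circleMap c ρ θ) :=
    fun z hz θ => hG.differentiableAt (hΩ.mem_nhds (hK ⟨hz, hcm θ⟩))
  have hderiv : ∀ z ∈ closedBall z₀ δ, ∀ θ, HasFDerivAt (fun z => G (z, circleMap c ρ θ))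
      ((fderiv ℂ G (z, circleMap c ρ θ)).comp (ContinuousLinearMap.inl ℂ E ℂ)) z :=
    fun z hz θ => (hdiff z hz θ).hasFDerivAt.comp z (hasFDerivAt_prodMk_left z _)
  have hderiv_circle : Continuous (deriv (circleMap c ρ)) := by
    rw [show deriv (circleMap c ρ) = fun θ => circleMap 0 ρ θ * Complex.I from
      funext fun θ => deriv_circleMap c ρ θ]
    fun_prop
  have hcont : ∀ z ∈ closedBall z₀ δ,
      Continuous fun θ => deriv (circleMap c ρ) θ • G (z, circleMap c ρ θ) := fun z hz => by
    refine hderiv_circle.fun_smul (continuous_iff_continuousAt.2 fun θ => ?_)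
    exact (hdiff z hz θ).continuousAt.comp (f := fun θ => (z, circleMap c ρ θ))
      (Continuous.continuousAt (by fun_prop))
  -- the Schwarz lemma bounds the derivatives by the bound `M` of `G`
  have hbound : ∀ z ∈ ball z₀ (δ / 2), ∀ θ,
      ‖(fderiv ℂ G (z, circleMap c ρ θ)).comp (ContinuousLinearMap.inl ℂ E ℂ)‖
        ≤ 2 * M / (δ / 2) := fun z hz θ => by
    have hsub : ball z (δ / 2) ⊆ closedBall z₀ δ :=
      (ball_subset_ball' (by rw [mem_ball] at hz; linarith)).trans ball_subset_closedBall
    rw [← (hderiv z (hsub (mem_ball_self (half_pos hδ))) θ).fderiv]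
    refine Complex.norm_fderiv_le_div_of_mapsTo_ball
      (fun w hw => (hderiv w (hsub hw) θ).differentiableAt.differentiableWithinAt)
      (fun w hw => ?_) (half_pos hδ)
    rw [mem_closedBall, dist_eq_norm]
    have := norm_sub_le (G (w, circleMap c ρ θ)) (G (z, circleMap c ρ θ))
    linarith [hM (w, circleMap c ρ θ) ⟨hsub hw, hcm θ⟩,
      hM (z, circleMap c ρ θ) ⟨hsub (mem_ball_self (half_pos hδ)), hcm θ⟩]
  have hmeas : AEStronglyMeasurable (fun θ => deriv (circleMap c ρ) θ •
      (fderiv ℂ G (z₀, circleMap c ρ θ)).comp (ContinuousLinearMap.inl ℂ E ℂ))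
      (volume.restrict (Set.uIoc 0 (2 * Real.pi))) := by
    borelize (E × ℂ)
    have h1 : Measurable fun θ => fderiv ℂ G (z₀, circleMap c ρ θ) :=
      (measurable_fderiv ℂ G).comp (Continuous.measurable (by fun_prop))
    have h2 : Continuous fun L : E × ℂ →L[ℂ] ℂ => L.comp (ContinuousLinearMap.inl ℂ E ℂ) := by
      fun_prop
    exact (hderiv_circle.stronglyMeasurable.smul
      (h2.comp_stronglyMeasurable h1.stronglyMeasurable)).aestronglyMeasurable
  have hz₀ : z₀ ∈ closedBall z₀ δ := mem_closedBall_self hδ.le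
  have hsub : ball z₀ (δ / 2) ⊆ closedBall z₀ δ :=
    (ball_subset_ball (by linarith)).trans ball_subset_closedBall
  refine (intervalIntegral.hasFDerivAt_integral_of_dominated_of_fderiv_le (𝕜 := ℂ)
    (bound := fun _ => ρ * (2 * M / (δ / 2))) (ball_mem_nhds z₀ (half_pos hδ))
    (F' := fun z θ => deriv (circleMap c ρ) θ •
      (fderiv ℂ G (z, circleMap c ρ θ)).comp (ContinuousLinearMap.inl ℂ E ℂ))
    ?_ ((hcont z₀ hz₀).intervalIntegrable _ _) hmeas ?_ intervalIntegrable_const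
    ?_).differentiableAt
  · filter_upwards [closedBall_mem_nhds z₀ hδ] with z hz
    exact (hcont z hz).aestronglyMeasurable
  · refine Filter.Eventually.of_forall fun θ _ z hz => ?_
    rw [norm_smul, deriv_circleMap]
    have : ‖circleMap 0 ρ θ * Complex.I‖ = ρ := by simp [abs_of_nonneg hρ]
    rw [this]
    exact mul_le_mul_of_nonneg_left (hbound z hz θ) hρ
  · exact Filter.Eventually.of_forall fun θ _ z hz => (hderiv z (hsub hz) θ).fun_const_smul _

open Metric in
/-- A holomorphic function on a polydisc is, up to its restriction to the hyperplane `z_i = x_i`,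
divisible by `z_i - x_i`. The quotient is jointly holomorphic by the Cauchy integral formula in the
`i`-th variable. -/
theorem exists_differentiableOn_eq_update_add_mul {ι : Type*} [Fintype ι] [DecidableEq ι]
    {g : (ι → ℂ) → ℂ} {x : ι → ℂ} {r : ℝ} (hg : DifferentiableOn ℂ g (ball x r)) (i : ι) :
    ∃ h : (ι → ℂ) → ℂ, DifferentiableOn ℂ h (ball x r) ∧
      ∀ z ∈ ball x r, g z = g (Function.update z i (x i)) + (z i - x i) * h z := by
  have hupd : ∀ {ρ : ℝ} {z : ι → ℂ} {t : ℂ}, z ∈ ball x ρ → t ∈ ball (x i) ρ →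
      Function.update z i t ∈ ball x ρ := by
    intro ρ z t hz ht
    have hρ := dist_nonneg.trans_lt hz
    rw [mem_ball, dist_pi_lt_iff hρ] at hz ⊢
    intro j
    by_cases hj : j = i
    · subst hj; simpa using ht
    · simpa [hj] using hz j
  have hupd' : Differentiable ℂ fun p : (ι → ℂ) × ℂ => Function.update p.1 i p.2 := by
    refine differentiable_pi.2 fun j => ?_
    by_cases hj : j = i
    · subst hj; simp only [Function.update_self]; fun_prop
    · simp only [Function.update_of_ne hj]
      fun_prop
  have hslice : ∀ z ∈ ball x r, DifferentiableOn ℂ (fun t => g (Function.update z i t))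
      (ball (x i) r) := fun z hz t ht =>
    ((hg.differentiableAt (isOpen_ball.mem_nhds (hupd hz ht))).comp t
      ((hupd' (z, t)).comp t (by fun_prop : DifferentiableAt ℂ (fun t => (z, t)) t)))
      |>.differentiableWithinAt
  have hz_i : ∀ {ρ : ℝ} {z : ι → ℂ}, z ∈ ball x ρ → z i ∈ ball (x i) ρ := fun hz =>
    (dist_le_pi_dist _ _ i).trans_lt hz
  refine ⟨fun z => dslope (fun t => g (Function.update z i t)) (x i) (z i), ?_, fun z hz => ?_⟩
  swap
  · have := sub_smul_dslope (fun t => g (Function.update z i t)) (x i) (z i)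
    simp only [Function.update_eq_self, smul_eq_mul] at this
    rw [this]
    ring
  intro z₀ hz₀
  -- near `z₀`, the quotient is a Cauchy integral over a circle on which `ζ ≠ x i` and `ζ ≠ z i`
  obtain ⟨ρ, hρ, hρr⟩ := exists_between (mem_ball.1 hz₀)
  have hρ0 : 0 < ρ := dist_nonneg.trans_lt hρ
  have hxr : x i ∈ ball (x i) r := mem_ball_self (hρ0.trans hρr)
  refine DifferentiableAt.differentiableWithinAt ?_
  let G : (ι → ℂ) × ℂ → ℂ := fun p => (p.2 - p.1 i)⁻¹ *
    ((p.2 - x i)⁻¹ * (g (Function.update p.1 i p.2) - g (Function.update p.1 i (x i))))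
  have hcauchy : ∀ z ∈ ball x ρ, dslope (fun t => g (Function.update z i t)) (x i) (z i) =
      (2 * Real.pi * Complex.I : ℂ)⁻¹ • ∮ ζ in C(x i, ρ), G (z, ζ) := by
    intro z hz
    have hd := (Complex.differentiableOn_dslope (isOpen_ball.mem_nhds hxr)).2
      (hslice z (ball_subset_ball hρr.le hz))
    rw [← (hd.mono ((closedBall_subset_ball hρr).trans
      subset_rfl)).diffContOnCl_ball subset_rfl |>.two_pi_i_inv_smul_circleIntegral_sub_inv_smul
      (hz_i hz)]
    congr 1
    refine circleIntegral.integral_congr hρ0.le fun ζ hζ => ?_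
    have : ζ ≠ x i := by
      rintro rfl
      rw [mem_sphere, dist_self] at hζ
      exact hρ0.ne hζ
    simp only [G]
    rw [dslope_of_ne _ this, slope_def_module, smul_eq_mul, smul_eq_mul]
  let Ω : Set ((ι → ℂ) × ℂ) := {p | p.1 ∈ ball x r ∧ p.2 ∈ ball (x i) r ∧ p.2 - p.1 i ≠ 0 ∧
    p.2 - x i ≠ 0}
  have hΩ : IsOpen Ω := by
    refine (isOpen_ball.preimage continuous_fst).inter
      ((isOpen_ball.preimage continuous_snd).inter (IsOpen.inter ?_ ?_))
    · exact isOpen_ne_fun (by fun_prop) continuous_const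
    · exact isOpen_ne_fun (by fun_prop) continuous_const
  have hGΩ : DifferentiableOn ℂ G Ω := by
    rintro p ⟨h1, h2, h3, h4⟩
    refine DifferentiableAt.differentiableWithinAt ?_
    refine DifferentiableAt.mul (DifferentiableAt.inv (by fun_prop) h3)
      (DifferentiableAt.mul (DifferentiableAt.inv (by fun_prop) h4) (DifferentiableAt.sub ?_ ?_))
    · exact (hg.differentiableAt (isOpen_ball.mem_nhds (hupd h1 h2))).comp p (hupd' p)
    · exact (hg.differentiableAt (isOpen_ball.mem_nhds (hupd h1 hxr))).comp p
        ((hupd' (p.1, x i)).comp (f := fun p : (ι → ℂ) × ℂ => (p.1, x i)) p (by fun_prop))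
  have key := differentiableAt_circleIntegral_of_differentiableOn hΩ hGΩ (z₀ := z₀) (c := x i)
    hρ0.le fun ζ hζ => ?_
  · refine (key.const_smul (2 * Real.pi * Complex.I : ℂ)⁻¹).congr_of_eventuallyEq ?_
    filter_upwards [isOpen_ball.mem_nhds (mem_ball.2 hρ)] with z hz using hcauchy z hz
  · rw [mem_sphere] at hζ
    refine ⟨hz₀, by rw [mem_ball, hζ]; exact hρr, fun h => ?_, fun h => ?_⟩
    · have := hz_i (mem_ball.2 hρ)
      rw [mem_ball, ← (sub_eq_zero.1 h : ζ = z₀ i), hζ] at this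
      exact lt_irrefl _ this
    · rw [(sub_eq_zero.1 h : ζ = x i), dist_self] at hζ
      exact hρ0.ne hζ

/-! ### Superfunctions -/

/-- A holomorphic function on `W`, as an even superfunction without odd variables. -/
noncomputable def superOfHolomorphic {m : ℕ} (n : ℕ) {W : Opens (Fin m → ℂ)}
    (g : (Fin m → ℂ) → ℂ) (hg : DifferentiableOn ℂ g (W : Set (Fin m → ℂ))) :
    superFunctions m n W :=
  ⟨fun z => algebraMap ℂ _ (g z), fun ν =>
    isHolomorphicFun_of_eqOn (hg.mul_const ((oddMonomials n).repr 1 ν)) fun z => by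
      simp [Algebra.algebraMap_eq_smul_one]⟩

/-- An element of `⋀ ℂⁿ`, as a constant superfunction. -/
noncomputable def superConst {m n : ℕ} (W : Opens (Fin m → ℂ)) (a : OddAlgebra n) :
    superFunctions m n W :=
  ⟨fun _ => a, fun ν => isHolomorphicFun_of_eqOn
    (differentiableOn_const ((oddMonomials n).repr a ν)) fun _ => rfl⟩

/-- The even coordinate `z_i`. -/
noncomputable def evenCoord {m : ℕ} (n : ℕ) (W : Opens (Fin m → ℂ)) (i : Fin m) :
    superFunctions m n W :=
  superOfHolomorphic n (fun z => z i) (by fun_prop)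

/-- The odd coordinate `ξ_j`. -/
noncomputable def oddCoord (m : ℕ) {n : ℕ} (W : Opens (Fin m → ℂ)) (j : Fin n) :
    superFunctions m n W :=
  superConst W (oddGen n j)

section

variable {m n : ℕ} {W : Opens (Fin m → ℂ)}

/-- The expansion `f = ∑_ν f_ν ξ^ν`. -/
theorem sum_superOfHolomorphic_mul_superConst (f : superFunctions m n W) :
    ∑ ν, superOfHolomorphic n _ (f.2 ν) * superConst W (oddMonomials n ν) = f := by
  refine Subtype.ext (funext fun z => ?_)
  refine Eq.trans ?_ ((oddMonomials n).sum_repr (f.1 z))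
  rw [AddSubmonoidClass.coe_finsetSum, Finset.sum_apply]
  refine Finset.sum_congr rfl fun ν _ => ?_
  change algebraMap ℂ _ (Function.extend _ _ _ _) * oddMonomials n ν = _
  rw [IsHolomorphicFun.extend_apply, Algebra.smul_def]

theorem exists_list_prod_eq_superConst (ν : Finset (Fin n)) :
    ∃ L : List (Fin n), L.length = ν.card ∧
      superConst W (oddMonomials n ν) = (L.map (oddCoord m W)).prod := by
  obtain ⟨L, hL, -, h⟩ := exists_list_prod_eq_oddMonomials ν
  refine ⟨L, hL, Subtype.ext (funext fun z => ?_)⟩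
  rw [← h]
  clear hL h
  induction L with
  | nil => rfl
  | cons j L ih =>
    rw [List.map_cons, List.prod_cons, List.map_cons, List.prod_cons]
    exact congrArg (oddGen n j * ·) ih

/-- The superfunctions all of whose terms have degree at least `l` in the odd variables, that is, the
power `J^l` of the ideal `J` generated by the odd coordinates. -/
noncomputable def superFiltration (n : ℕ) (W : Opens (Fin m → ℂ)) (l : ℕ) :
    Submodule ℂ (superFunctions m n W) where
  carrier := {f | ∀ z, f.1 z ∈ oddFiltration n l}
  add_mem' hf hg z := add_mem (hf z) (hg z)
  zero_mem' _ := zero_mem _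
  smul_mem' a _ hf z := Submodule.smul_mem _ a (hf z)

theorem mul_mem_superFiltration {k l : ℕ} {f g : superFunctions m n W}
    (hf : f ∈ superFiltration n W k) (hg : g ∈ superFiltration n W l) :
    f * g ∈ superFiltration n W (k + l) := fun z => mul_mem_oddFiltration (hf z) (hg z)

theorem mem_superFiltration_zero (f : superFunctions m n W) : f ∈ superFiltration n W 0 :=
  fun _ => mem_oddFiltration_zero _

theorem superFiltration_anti {k l : ℕ} (h : k ≤ l) :
    superFiltration n W l ≤ superFiltration n W k := fun _ hf z => oddFiltration_anti h (hf z)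

theorem mem_superFiltration_one {f : superFunctions m n W} :
    f ∈ superFiltration n W 1 ↔ ∀ z, oddBody n (f.1 z) = 0 :=
  forall_congr' fun _ => mem_oddFiltration_one

theorem eq_zero_of_mem_superFiltration {f : superFunctions m n W}
    (hf : f ∈ superFiltration n W (n + 1)) : f = 0 :=
  Subtype.ext (funext fun z => eq_zero_of_mem_oddFiltration (hf z))

theorem oddCoord_mem_superFiltration (j : Fin n) : oddCoord m W j ∈ superFiltration n W 1 :=
  fun _ => oddGen_mem_oddFiltration j

theorem pow_mem_superFiltration {f : superFunctions m n W} (hf : f ∈ superFiltration n W 1)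
    (k : ℕ) : f ^ k ∈ superFiltration n W k := fun z => pow_mem_oddFiltration (hf z) k

/-- A superfunction whose body has no zeros is invertible, being the sum of its body and a nilpotent
superfunction. -/
theorem isUnit_of_oddBody_ne_zero {f : superFunctions m n W} (h : ∀ z, oddBody n (f.1 z) ≠ 0) :
    IsUnit f := by
  have hb : ∀ z : W, Function.extend Subtype.val
      (fun z : W => (oddMonomials n).repr (f.1 z) ∅) 0 z = oddBody n (f.1 z) := fun z => by
    rw [IsHolomorphicFun.extend_apply, oddMonomials_repr_empty]
  let b : superFunctions m n W := superOfHolomorphic n _ (f.2 ∅)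
  have hbz : ∀ z, b.1 z = algebraMap ℂ _ (oddBody n (f.1 z)) := fun z =>
    congrArg (algebraMap ℂ (OddAlgebra n)) (hb z)
  let b' : superFunctions m n W := superOfHolomorphic n _
    ((f.2 ∅).fun_inv fun z hz => by
      rw [hb ⟨z, hz⟩]
      exact h _)
  have hbz' : ∀ z, b'.1 z = algebraMap ℂ _ (oddBody n (f.1 z))⁻¹ := fun z =>
    congrArg (fun t => algebraMap ℂ (OddAlgebra n) t⁻¹) (hb z)
  have hcomm : ∀ g : superFunctions m n W, b * g = g * b := fun g =>
    Subtype.ext (funext fun z => by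
      change b.1 z * g.1 z = g.1 z * b.1 z
      rw [hbz]
      exact Algebra.commutes _ _)
  have hb_unit : IsUnit b := by
    have h1 : b * b' = 1 := Subtype.ext (funext fun z => by
      change b.1 z * b'.1 z = 1
      rw [hbz, hbz', ← map_mul, mul_inv_cancel₀ (h z), map_one])
    exact ⟨⟨b, b', h1, hcomm b' ▸ h1⟩, rfl⟩
  have hnil : IsNilpotent (f - b) := by
    refine ⟨n + 1, eq_zero_of_mem_superFiltration (pow_mem_superFiltration ?_ _)⟩
    refine mem_superFiltration_one.2 fun z => ?_
    change oddBody n (f.1 z - b.1 z) = 0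
    rw [hbz, map_sub, AlgHom.commutes]
    exact sub_self _
  rw [← add_sub_cancel b f]
  exact hnil.isUnit_add_left_of_commute hb_unit (hcomm _).symm

/-! ### Endomorphisms of an algebra of superfunctions over the identity -/

/-- A property of superfunctions stable under sums that holds for all `a ξ_{j_1} ⋯ ξ_{j_k}` with
`k ≥ l` holds for all superfunctions whose terms have degree at least `l`. -/
theorem superFiltration_induction {l : ℕ} {P : superFunctions m n W → Prop}
    (h0 : P 0) (hadd : ∀ f g, P f → P g → P (f + g))
    (hmon : ∀ (a : superFunctions m n W) (L : List (Fin n)), l ≤ L.length →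
      P (a * (L.map (oddCoord m W)).prod))
    {f : superFunctions m n W} (hf : f ∈ superFiltration n W l) : P f := by
  rw [← sum_superOfHolomorphic_mul_superConst f]
  refine Finset.sum_induction _ P hadd h0 fun ν _ => ?_
  by_cases hν : ν.card < l
  · convert h0
    refine Subtype.ext (funext fun z => ?_)
    change algebraMap ℂ (OddAlgebra n) (Function.extend _ _ _ _) * _ = 0
    rw [IsHolomorphicFun.extend_apply, hf z ν hν, map_zero, zero_mul]
  · obtain ⟨L, hL, h⟩ := exists_list_prod_eq_superConst (W := W) ν
    rw [h]
    exact hmon _ L (by omega)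

variable {τ : superFunctions m n W →ₐ[ℂ] superFunctions m n W}

theorem apply_sub_self_mem_superFiltration_one
    (hτ : ∀ f z, oddBody n ((τ f).1 z) = oddBody n (f.1 z)) (f : superFunctions m n W) :
    τ f - f ∈ superFiltration n W 1 :=
  mem_superFiltration_one.2 fun z => by
    change oddBody n ((τ f).1 z - f.1 z) = 0
    rw [map_sub, hτ, sub_self]

theorem prod_map_mem_superFiltration
    (hτ : ∀ f z, oddBody n ((τ f).1 z) = oddBody n (f.1 z)) (L : List (Fin n)) :
    τ (L.map (oddCoord m W)).prod ∈ superFiltration n W L.length := by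
  induction L with
  | nil => exact mem_superFiltration_zero _
  | cons j L ih =>
    rw [List.map_cons, List.prod_cons, map_mul, List.length_cons, add_comm]
    refine mul_mem_superFiltration (mem_superFiltration_one.2 fun z => ?_) ih
    rw [hτ]
    exact mem_superFiltration_one.1 (oddCoord_mem_superFiltration j) z

theorem apply_mem_superFiltration
    (hτ : ∀ f z, oddBody n ((τ f).1 z) = oddBody n (f.1 z)) {l : ℕ} {f : superFunctions m n W}
    (hf : f ∈ superFiltration n W l) : τ f ∈ superFiltration n W l := by
  refine superFiltration_induction (P := fun f => τ f ∈ superFiltration n W l)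
    (by rw [map_zero]; exact zero_mem _)
    (fun f g hf hg => by rw [map_add]; exact add_mem hf hg) (fun a L hL => ?_) hf
  rw [map_mul]
  have := mul_mem_superFiltration (mem_superFiltration_zero (τ a))
    (prod_map_mem_superFiltration hτ L)
  exact superFiltration_anti (by omega) this

/-- If `τ` is the identity modulo `J` and fixes the odd coordinates modulo `J²`, then `τ - 1` raises
the filtration by the powers of `J`. -/
theorem apply_sub_self_mem_superFiltration
    (hτ : ∀ f z, oddBody n ((τ f).1 z) = oddBody n (f.1 z))
    (hodd : ∀ j, τ (oddCoord m W j) - oddCoord m W j ∈ superFiltration n W 2) {l : ℕ}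
    {f : superFunctions m n W} (hf : f ∈ superFiltration n W l) :
    τ f - f ∈ superFiltration n W (l + 1) := by
  refine superFiltration_induction (P := fun f => τ f - f ∈ superFiltration n W (l + 1))
    (by rw [map_zero, sub_zero]; exact zero_mem _)
    (fun f g hf hg => by
      rw [map_add, add_sub_add_comm]
      exact add_mem hf hg) (fun a L hL => ?_) hf
  have hL' : τ (L.map (oddCoord m W)).prod - (L.map (oddCoord m W)).prod ∈
      superFiltration n W (L.length + 1) := by
    clear hL
    induction L with
    | nil => rw [List.map_nil, List.prod_nil, map_one, sub_self]; exact zero_mem _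
    | cons j L ih =>
      rw [List.map_cons, List.prod_cons, map_mul]
      set p := (L.map (oddCoord m W)).prod
      have e : τ (oddCoord m W j) * τ p - oddCoord m W j * p =
          (τ (oddCoord m W j) - oddCoord m W j) * τ p + oddCoord m W j * (τ p - p) := by
        rw [sub_mul, mul_sub, sub_add_sub_cancel]
      rw [e, List.length_cons]
      refine add_mem (superFiltration_anti (by omega)
        (mul_mem_superFiltration (hodd j) (prod_map_mem_superFiltration hτ L)))
        (superFiltration_anti (by omega)
          (mul_mem_superFiltration (oddCoord_mem_superFiltration j) ih))
  rw [map_mul]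
  set p := (L.map (oddCoord m W)).prod
  have e : τ a * τ p - a * p = (τ a - a) * τ p + a * (τ p - p) := by
    rw [sub_mul, mul_sub, sub_add_sub_cancel]
  rw [e]
  exact add_mem (superFiltration_anti (by omega) (mul_mem_superFiltration
      (apply_sub_self_mem_superFiltration_one hτ a) (prod_map_mem_superFiltration hτ L)))
    (superFiltration_anti (by omega)
      (mul_mem_superFiltration (mem_superFiltration_zero a) hL'))

/-- The matrix, at the point `z`, of the linear map induced by `τ` on `J / J²`. -/
noncomputable def oddJacobian (τ : superFunctions m n W →ₐ[ℂ] superFunctions m n W) (z : W) :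
    Matrix (Fin n) (Fin n) ℂ :=
  .of fun k j => (oddMonomials n).repr ((τ (oddCoord m W j)).1 z) {k}

/-- On `J / J²`, `τ` acts by the matrix `oddJacobian τ z`. -/
theorem repr_singleton_apply (hτ : ∀ f z, oddBody n ((τ f).1 z) = oddBody n (f.1 z))
    {f : superFunctions m n W} (hf : f ∈ superFiltration n W 1) (z : W) (k : Fin n) :
    (oddMonomials n).repr ((τ f).1 z) {k} =
      ∑ j, oddJacobian τ z k j * (oddMonomials n).repr (f.1 z) {j} := by
  let a : Fin n → superFunctions m n W := fun j => superOfHolomorphic n _ (f.2 {j})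
  have haz : ∀ j z, (a j).1 z = algebraMap ℂ _ ((oddMonomials n).repr (f.1 z) {j}) := fun j z =>
    congrArg (algebraMap ℂ (OddAlgebra n)) (IsHolomorphicFun.extend_apply _ z)
  -- modulo `J²`, `f` is `∑ a_j ξ_j` and `τ f` is `∑ a_j τ(ξ_j)`
  have h1 : f - ∑ j, a j * oddCoord m W j ∈ superFiltration n W 2 := by
    intro z μ hμ
    have hval : (f - ∑ j, a j * oddCoord m W j).1 z =
        f.1 z - ∑ j, (oddMonomials n).repr (f.1 z) {j} • oddMonomials n {j} := by
      rw [AddSubgroupClass.coe_sub, Pi.sub_apply, AddSubmonoidClass.coe_finsetSum,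
        Finset.sum_apply]
      congr 1
      refine Finset.sum_congr rfl fun j _ => ?_
      change (a j).1 z * oddGen n j = _
      rw [haz, Algebra.smul_def, oddMonomials_singleton]
    rw [hval, map_sub, Finsupp.sub_apply, map_sum, Finsupp.coe_finsetSum, Finset.sum_apply]
    simp only [map_smul, Module.Basis.repr_self, Finsupp.smul_single, smul_eq_mul, mul_one,
      Finsupp.single_apply]
    rcases Nat.lt_succ_iff_lt_or_eq.1 hμ with h | h
    · obtain rfl : μ = ∅ := by simpa using h
      rw [hf z ∅ (by simp)]
      simp
    · obtain ⟨i, rfl⟩ := Finset.card_eq_one.1 h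
      simp
  have h2 : τ f - ∑ j, a j * τ (oddCoord m W j) ∈ superFiltration n W 2 := by
    have h3 := apply_mem_superFiltration hτ h1
    have h4 : ∑ j, (τ (a j) - a j) * τ (oddCoord m W j) ∈ superFiltration n W 2 :=
      sum_mem fun j _ => mul_mem_superFiltration (k := 1) (l := 1)
        (apply_sub_self_mem_superFiltration_one hτ _)
        (apply_mem_superFiltration hτ (oddCoord_mem_superFiltration j))
    convert add_mem h3 h4 using 1
    simp only [map_sub, map_sum, map_mul, sub_mul, Finset.sum_sub_distrib]
    abel
  have h5 := h2 z {k} (by simp)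
  rw [AddSubgroupClass.coe_sub, Pi.sub_apply, AddSubmonoidClass.coe_finsetSum,
    Finset.sum_apply, map_sub, Finsupp.sub_apply, sub_eq_zero, map_sum, Finsupp.coe_finsetSum,
    Finset.sum_apply] at h5
  rw [h5]
  refine Finset.sum_congr rfl fun j _ => ?_
  change (oddMonomials n).repr ((a j).1 z * (τ (oddCoord m W j)).1 z) {k} = _
  rw [haz, ← Algebra.smul_def, map_smul, Finsupp.smul_apply, smul_eq_mul, mul_comm]
  rfl

theorem repr_pow_oddCoord (hτ : ∀ f z, oddBody n ((τ f).1 z) = oddBody n (f.1 z)) (s : ℕ)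
    (j k : Fin n) (z : W) :
    (oddMonomials n).repr (((τ ^ s) (oddCoord m W j)).1 z) {k} = (oddJacobian τ z ^ s) k j := by
  induction s generalizing k with
  | zero =>
    change (oddMonomials n).repr (oddGen n j) {k} = (1 : Matrix (Fin n) (Fin n) ℂ) k j
    rw [← oddMonomials_singleton, Module.Basis.repr_self, Finsupp.single_apply, Matrix.one_apply]
    simp [eq_comm]
  | succ s ih =>
    have hmem : (τ ^ s) (oddCoord m W j) ∈ superFiltration n W 1 := by
      clear ih
      induction s with
      | zero => exact oddCoord_mem_superFiltration j
      | succ s ih =>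
        rw [pow_succ', AlgHom.mul_apply]
        exact apply_mem_superFiltration hτ ih
    rw [pow_succ', AlgHom.mul_apply, repr_singleton_apply hτ hmem, pow_succ', Matrix.mul_apply]
    simp only [ih]

/-- If the odd coordinates stay close to themselves under all powers of `τ`, then `τ` induces the
identity on `J / J²`. -/
theorem oddJacobian_eq_one (hτ : ∀ f z, oddBody n ((τ f).1 z) = oddBody n (f.1 z))
    (hodd : ∀ (s : ℕ) (j : Fin n) (z : W) (ν : Finset (Fin n)),
      ‖(oddMonomials n).repr (((τ ^ s) (oddCoord m W j)).1 z) ν -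
        (oddMonomials n).repr (oddGen n j) ν‖ ≤ 1 / (2 * (n + 1))) (z : W) :
    oddJacobian τ z = 1 := by
  let _ : NormedRing (Matrix (Fin n) (Fin n) ℂ) := Matrix.linftyOpNormedRing
  let _ : NormedAlgebra ℝ (Matrix (Fin n) (Fin n) ℂ) := Matrix.linftyOpNormedAlgebra
  refine eq_one_of_forall_norm_pow_sub_one_le fun s => ?_
  rw [Matrix.linfty_opNorm_def, show (1 / 2 : ℝ) = ((1 / 2 : NNReal) : ℝ) by norm_num,
    NNReal.coe_le_coe]
  refine Finset.sup_le fun k _ => ?_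
  rw [← NNReal.coe_le_coe, NNReal.coe_sum]
  have hle : ∀ j ∈ Finset.univ, ((‖(oddJacobian τ z ^ s - 1) k j‖₊ : NNReal) : ℝ) ≤
      1 / (2 * ((n : ℝ) + 1)) := by
    intro j _
    have h := hodd s j z {k}
    have h0 := repr_pow_oddCoord hτ 0 j k z
    rw [repr_pow_oddCoord hτ] at h
    rw [pow_zero, pow_zero] at h0
    rw [coe_nnnorm, Matrix.sub_apply, ← h0]
    exact h
  -- the row sums of `A ^ s - 1` are at most `n / (2 * (n + 1)) ≤ 1 / 2`
  refine (Finset.sum_le_card_nsmul _ _ _ hle).trans ?_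
  rw [Finset.card_univ, Fintype.card_fin, nsmul_eq_mul]
  push_cast
  rw [mul_one_div, div_le_div_iff₀ (by positivity) (by norm_num)]
  linarith

/-- If the coordinates stay close to themselves under all powers of `τ`, then `τ` fixes them. -/
theorem apply_coord_eq_self (hτ : ∀ f z, oddBody n ((τ f).1 z) = oddBody n (f.1 z))
    (hodd : ∀ (s : ℕ) (j : Fin n) (z : W) (ν : Finset (Fin n)),
      ‖(oddMonomials n).repr (((τ ^ s) (oddCoord m W j)).1 z) ν -
        (oddMonomials n).repr (oddGen n j) ν‖ ≤ 1 / (2 * (n + 1)))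
    (heven : ∀ (s : ℕ) (i : Fin m) (z : W) (ν : Finset (Fin n)), ν ≠ ∅ →
      ‖(oddMonomials n).repr (((τ ^ s) (evenCoord n W i)).1 z) ν‖ ≤ 1) :
    (∀ i, τ (evenCoord n W i) = evenCoord n W i) ∧ ∀ j, τ (oddCoord m W j) = oddCoord m W j := by
  have hodd2 : ∀ j, τ (oddCoord m W j) - oddCoord m W j ∈ superFiltration n W 2 := by
    intro j z ν hν
    rcases Nat.lt_succ_iff_lt_or_eq.1 hν with h | h
    · exact apply_sub_self_mem_superFiltration_one hτ _ z ν h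
    · obtain ⟨k, rfl⟩ := Finset.card_eq_one.1 h
      have h0 := repr_pow_oddCoord hτ 0 j k z
      have h1 := repr_pow_oddCoord hτ 1 j k z
      rw [oddJacobian_eq_one hτ hodd z, one_pow] at h0 h1
      rw [AddSubgroupClass.coe_sub, Pi.sub_apply, map_sub, Finsupp.sub_apply, sub_eq_zero]
      rw [pow_one] at h1
      exact h1.trans h0.symm
  -- powers of `τ` as an algebra endomorphism and as a linear map agree
  have hpow : ∀ (s : ℕ) f, (τ.toLinearMap ^ s) f = (τ ^ s) f := by
    intro s
    induction s with
    | zero => exact fun _ => rfl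
    | succ s ih =>
      intro f
      rw [pow_succ', Module.End.mul_apply, ih, pow_succ', AlgHom.mul_apply]
      rfl
  have hN : ∀ (k : ℕ) f, ((τ.toLinearMap - 1) ^ k) f ∈ superFiltration n W k := by
    intro k f
    induction k with
    | zero => exact mem_superFiltration_zero _
    | succ k ih =>
      rw [pow_succ', Module.End.mul_apply]
      exact apply_sub_self_mem_superFiltration hτ hodd2 ih
  have key : ∀ u, (∀ z ν, ∃ C, ∀ s : ℕ, ‖(oddMonomials n).repr (((τ ^ s) u).1 z) ν‖ ≤ C) →
      τ u = u := by
    intro u hu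
    refine apply_eq_self_of_unipotent_of_bounded τ.toLinearMap
      (fun p : W × Finset (Fin n) => (oddMonomials n).coord p.2 ∘ₗ LinearMap.proj p.1 ∘ₗ
        (superFunctions m n W).val.toLinearMap) (fun v hv => ?_) n u
      (eq_zero_of_mem_superFiltration (hN _ _)) fun p => ?_
    · refine Subtype.ext (funext fun z => (oddMonomials n).ext_elem fun ν => ?_)
      refine (hv (z, ν)).trans ?_
      change 0 = (oddMonomials n).repr 0 ν
      simp
    · obtain ⟨C, hC⟩ := hu p.1 p.2
      exact ⟨C, fun s => by rw [hpow]; exact hC s⟩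
  refine ⟨fun i => key _ fun z ν => ?_, fun j => key _ fun z ν => ?_⟩
  · by_cases hν : ν = ∅
    -- the body of `z_i` does not change at all
    · subst hν
      refine ⟨‖oddBody n ((evenCoord n W i).1 z)‖, fun s => le_of_eq ?_⟩
      rw [oddMonomials_repr_empty]
      congr 1
      induction s with
      | zero => rfl
      | succ s ih => rw [pow_succ', AlgHom.mul_apply, hτ, ih]
    · exact ⟨1, fun s => heven s i z ν hν⟩
  · refine ⟨1 / (2 * (n + 1)) + ‖(oddMonomials n).repr (oddGen n j) ν‖, fun s => ?_⟩
    have := norm_sub_norm_le ((oddMonomials n).repr (((τ ^ s) (oddCoord m W j)).1 z) ν)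
      ((oddMonomials n).repr (oddGen n j) ν)
    linarith [hodd s j z ν]

open Metric in
/-- An endomorphism that fixes the coordinates fixes the values of holomorphic functions at the
centre `x` of a polydisc. Subtracting a multiple of `z_i - x_i`, which changes neither side, makes a
function independent of `z_i`; in the end it is constant. -/
theorem apply_superOfHolomorphic_apply_center (hev : ∀ i, τ (evenCoord n W i) = evenCoord n W i)
    {x : Fin m → ℂ} {r : ℝ} (hW : (W : Set (Fin m → ℂ)) = ball x r) (hx : x ∈ W)
    {g : (Fin m → ℂ) → ℂ} (hg : DifferentiableOn ℂ g (W : Set (Fin m → ℂ))) :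
    (τ (superOfHolomorphic n g hg)).1 ⟨x, hx⟩ = algebraMap ℂ _ (g x) := by
  suffices H : ∀ (s : Finset (Fin m)) (g : (Fin m → ℂ) → ℂ)
      (hg : DifferentiableOn ℂ g (W : Set (Fin m → ℂ))),
      (∀ z ∈ W, g z = g (s.piecewise z x)) →
      (τ (superOfHolomorphic n g hg)).1 ⟨x, hx⟩ = algebraMap ℂ _ (g x) from
    H Finset.univ g hg fun z _ => by rw [Finset.piecewise_univ]
  clear hg g
  intro s
  have hmem : ∀ z : Fin m → ℂ, z ∈ W ↔ dist z x < r := fun z => by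
    rw [← mem_ball, ← hW, SetLike.mem_coe]
  have hr : 0 < r := dist_nonneg.trans_lt ((hmem x).1 hx)
  have hclose : ∀ {z w : Fin m → ℂ}, z ∈ W → (∀ i, w i = z i ∨ w i = x i) → w ∈ W := by
    intro z w hz hw
    rw [hmem, dist_pi_lt_iff hr] at hz ⊢
    intro i
    rcases hw i with h | h
    · rw [h]; exact hz i
    · rw [h, dist_self]; exact hr
  induction s using Finset.induction with
  | empty =>
    intro g hg h
    have : superOfHolomorphic n g hg = algebraMap ℂ (superFunctions m n W) (g x) :=
      Subtype.ext (funext fun z => by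
        change algebraMap ℂ _ (g z) = algebraMap ℂ _ (g x)
        rw [h z z.2, Finset.piecewise_empty])
    rw [this, AlgHom.commutes]
    rfl
  | insert i s hi ih =>
    intro g hg hgs
    obtain ⟨h, hh, hdiv⟩ := exists_differentiableOn_eq_update_add_mul (hW ▸ hg) i
    rw [← hW] at hh
    have hg' : DifferentiableOn ℂ (fun z => g z - (z i - x i) * h z) (W : Set (Fin m → ℂ)) :=
      hg.sub (DifferentiableOn.mul (by fun_prop) hh)
    have hg'_eq : ∀ z ∈ W, g z - (z i - x i) * h z = g (Function.update z i (x i)) := by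
      intro z hz
      rw [hdiv z (hW ▸ hz), add_sub_cancel_right]
    have hupd : ∀ z ∈ W, Function.update z i (x i) ∈ W := fun z hz => hclose hz fun j => by
      by_cases hj : j = i
      · subst hj; simp
      · simp [hj]
    have h1 := ih _ hg' fun z hz => by
      have hz' : s.piecewise z x ∈ W := hclose hz fun j => by
        by_cases hj : j ∈ s <;> simp [hj]
      rw [hg'_eq z hz, hg'_eq _ hz', hgs _ (hupd z hz), hgs _ (hupd _ hz')]
      congr 1
      funext j
      by_cases hj : j = i
      · subst hj; simp
      · by_cases hjs : j ∈ s <;> simp [hj, hjs]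
    have hsplit : superOfHolomorphic n g hg = superOfHolomorphic n _ hg' +
        (evenCoord n W i - algebraMap ℂ _ (x i)) * superOfHolomorphic n h hh :=
      Subtype.ext (funext fun z => by
        change algebraMap ℂ (OddAlgebra n) (g z) =
          algebraMap ℂ (OddAlgebra n) (g z - (z.1 i - x i) * h z) +
          (algebraMap ℂ (OddAlgebra n) (z.1 i) - algebraMap ℂ (OddAlgebra n) (x i)) *
            algebraMap ℂ (OddAlgebra n) (h z)
        rw [← map_sub, ← map_mul, ← map_add, sub_add_cancel])
    rw [hsplit, map_add, map_mul, map_sub, AlgHom.commutes, hev]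
    change (τ (superOfHolomorphic n _ hg')).1 ⟨x, hx⟩ +
      (algebraMap ℂ (OddAlgebra n) (x i) - algebraMap ℂ (OddAlgebra n) (x i)) * _ = _
    rw [h1, sub_self, sub_self, zero_mul, zero_mul, sub_zero, add_zero]

open Metric in
/-- An endomorphism that fixes the coordinates fixes the values of all superfunctions at the centre
of a polydisc. -/
theorem apply_apply_center (hev : ∀ i, τ (evenCoord n W i) = evenCoord n W i)
    (hodd : ∀ j, τ (oddCoord m W j) = oddCoord m W j)
    {x : Fin m → ℂ} {r : ℝ} (hW : (W : Set (Fin m → ℂ)) = ball x r) (hx : x ∈ W)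
    (f : superFunctions m n W) : (τ f).1 ⟨x, hx⟩ = f.1 ⟨x, hx⟩ := by
  rw [← sum_superOfHolomorphic_mul_superConst f, map_sum, AddSubmonoidClass.coe_finsetSum,
    AddSubmonoidClass.coe_finsetSum, Finset.sum_apply, Finset.sum_apply]
  refine Finset.sum_congr rfl fun ν _ => ?_
  have hν : τ (superConst W (oddMonomials n ν)) = superConst W (oddMonomials n ν) := by
    obtain ⟨L, -, h⟩ := exists_list_prod_eq_superConst (W := W) ν
    rw [h, map_list_prod, List.map_map]
    exact congrArg List.prod (List.map_congr_left fun j _ => hodd j)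
  rw [map_mul, hν]
  exact congrArg (· * oddMonomials n ν) (apply_superOfHolomorphic_apply_center hev hW hx _)

end

/-! ### Pullback of sections and their values in a superchart -/

namespace Superspace

variable {X Y Z : Superspace.{u}}

theorem res_res {U V W : Opens X.space} (h : V ≤ U) (h' : W ≤ V) (s : X.sections U) :
    X.res h' (X.res h s) = X.res (h'.trans h) s := by
  change ((X.space.presheaf.map (homOfLE h).op) ≫ (X.space.presheaf.map (homOfLE h').op)).hom s = _
  rw [← Functor.map_comp]
  rfl

theorem res_self {U : Opens X.space} (s : X.sections U) : X.res le_rfl s = s := by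
  change (X.space.presheaf.map (𝟙 (op U))).hom s = s
  rw [CategoryTheory.Functor.map_id]
  rfl

/-- The pullback `φ^* : 𝒪_Y(U) → 𝒪_X(V)` of sections for `V ⊆ φ̃⁻¹(U)`. Stating it for all such `V`
avoids casts along equalities of open sets. -/
def Hom.pullbackOn (φ : X ⟶ Y) {U : Opens Y.space} {V : Opens X.space}
    (h : V ≤ Hom.preimage φ U) : Y.sections U →ₐ[ℂ] X.sections V :=
  (X.res h).comp (Hom.pullback φ U)

theorem Hom.mem_preimage {φ : X ⟶ Y} {U : Opens Y.space} {x : X.space} :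
    x ∈ Hom.preimage φ U ↔ Hom.base φ x ∈ U := Iff.rfl

theorem res_pullbackOn (φ : X ⟶ Y) {U : Opens Y.space} {V V' : Opens X.space}
    (h : V ≤ Hom.preimage φ U) (h' : V' ≤ V) (s : Y.sections U) :
    X.res h' (Hom.pullbackOn φ h s) = Hom.pullbackOn φ (h'.trans h) s :=
  res_res h h' _

theorem pullbackOn_res (φ : X ⟶ Y) {U U' : Opens Y.space} {V : Opens X.space}
    (h' : U' ≤ U) (h : V ≤ Hom.preimage φ U') (s : Y.sections U) :
    Hom.pullbackOn φ h (Y.res h' s) = Hom.pullbackOn φ (h.trans fun _ hx => h' hx) s := by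
  have hnat := (Hom.toHom φ).hom.c.naturality (homOfLE h').op
  have : Hom.pullback φ U' (Y.res h' s) = X.res (fun _ hx => h' hx) (Hom.pullback φ U s) :=
    congrArg (fun f => f.hom s) hnat
  exact (congrArg (X.res h) this).trans (res_res _ h _)

theorem pullbackOn_comp (φ : X ⟶ Y) (ψ : Y ⟶ Z) {U : Opens Z.space} {V : Opens Y.space}
    {W : Opens X.space} (h : V ≤ Hom.preimage ψ U) (h' : W ≤ Hom.preimage φ V)
    (h'' : W ≤ Hom.preimage (φ ≫ ψ) U) (s : Z.sections U) :
    Hom.pullbackOn (φ ≫ ψ) h'' s = Hom.pullbackOn φ h' (Hom.pullbackOn ψ h s) := by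
  change _ = Hom.pullbackOn φ h' (Y.res h (Hom.pullback ψ U s))
  rw [pullbackOn_res]
  rfl

/-- Sections are determined by their restrictions to small neighbourhoods of the points. -/
theorem sections_ext {U : Opens X.space} {s t : X.sections U}
    (h : ∀ x ∈ U, ∃ (V : Opens X.space) (hV : V ≤ U), x ∈ V ∧ X.res hV s = X.res hV t) :
    s = t := by
  choose V hV hx hst using h
  refine TopCat.Sheaf.eq_of_locally_eq' X.space.sheaf (fun x : U => V x x.2) U
    (fun x => homOfLE (hV x x.2)) (fun x hxU => ?_) s t fun x => hst x x.2
  exact Opens.mem_iSup.2 ⟨⟨x, hxU⟩, hx x hxU⟩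

/-- An endomorphism that is the identity on points and on sections is the identity. -/
theorem eq_id_of_pullbackOn_eq_res {φ : X ⟶ X} (hbase : ∀ x, Hom.base φ x = x)
    (hsec : ∀ {U V : Opens X.space} (h : V ≤ Hom.preimage φ U) (h' : V ≤ U) (s : X.sections U),
      Hom.pullbackOn φ h s = X.res h' s) : φ = 𝟙 X := by
  refine Superspace.Hom.ext ?_
  refine AlgebraicGeometry.SheafedSpace.ext _ _ (TopCat.hom_ext (ContinuousMap.ext hbase)) ?_
  refine NatTrans.ext (funext fun U => AlgCat.hom_ext _ (AlgHom.ext fun s => ?_))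
  have hle : U.unop ≤ Hom.preimage φ U.unop := fun x hx => by
    have : Hom.base φ x = x := hbase x
    rwa [← this] at hx
  exact (hsec hle le_rfl s).trans (res_self s)

end Superspace

namespace SuperChart

variable {X Y : Superspace.{u}} {m n : ℕ}

/-- The value in `⋀ ℂⁿ`, at a point `x` of `W`, of a section over an open subset `W` of the domain of
a superchart. -/
noncomputable def eval (c : SuperChart X m n) {W : Opens X.space} (hW : W ≤ c.source) (x : W) :
    X.sections W →ₐ[ℂ] OddAlgebra n :=
  ((Pi.evalAlgHom ℂ _ ⟨c.homeo x, x, x.2, rfl⟩).comp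
    (superFunctions m n (imageOpens c.homeo W hW)).val).comp (c.iso W hW).toAlgHom

theorem coeff_eq (c : SuperChart X m n) {W : Opens X.space} (hW : W ≤ c.source)
    (f : X.sections W) (ν : Finset (Fin n)) (x : W) :
    c.coeff hW f ν x = (oddMonomials n).repr (c.eval hW x f) ν := rfl

theorem eval_res (c : SuperChart X m n) {V W : Opens X.space} (h : V ≤ W) (hW : W ≤ c.source)
    (f : X.sections W) (x : V) :
    c.eval (h.trans hW) x (X.res h f) = c.eval hW ⟨x, h x.2⟩ f := by
  change (c.iso V _ (X.res h f)).1 _ = _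
  rw [c.iso_res h hW]
  rfl

theorem eq_of_eval_eq (c : SuperChart X m n) {W : Opens X.space} (hW : W ≤ c.source)
    {f g : X.sections W} (h : ∀ x, c.eval hW x f = c.eval hW x g) : f = g := by
  refine (c.iso W hW).injective (Subtype.ext (funext ?_))
  rintro ⟨_, x, hx, rfl⟩
  exact h ⟨x, hx⟩

theorem isUnit_of_oddBody_eval_ne_zero (c : SuperChart X m n) {W : Opens X.space}
    (hW : W ≤ c.source) {f : X.sections W} (h : ∀ x, oddBody n (c.eval hW x f) ≠ 0) :
    IsUnit f := by
  have : IsUnit (c.iso W hW f) := by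
    refine isUnit_of_oddBody_ne_zero ?_
    rintro ⟨_, x, hx, rfl⟩
    exact h ⟨x, hx⟩
  simpa using this.map (c.iso W hW).symm

theorem continuous_oddBody_eval (c : SuperChart X m n) {W : Opens X.space} (hW : W ≤ c.source)
    (f : X.sections W) : Continuous fun x => oddBody n (c.eval hW x f) := by
  have h1 := ((c.iso W hW f).2 ∅).continuousOn
  have h2 : Continuous fun x : W => c.homeo x := by
    exact c.homeo.continuousOn.comp_continuous continuous_subtype_val fun x => hW x.2
  refine (h1.comp_continuous h2 fun x => ⟨x, x.2, rfl⟩).congr fun x => ?_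
  rw [← oddMonomials_repr_empty]
  exact IsHolomorphicFun.extend_apply (fun z : imageOpens c.homeo W hW =>
    (oddMonomials n).repr ((c.iso W hW f).1 z) ∅) ⟨c.homeo x, x, x.2, rfl⟩

/-- Morphisms are compatible with the evaluation of bodies: the body of `φ^* f` at `x` is the body
of `f` at `φ̃ x`. If these two numbers were different, `f` minus the first would be invertible near
`φ̃ x`, and its pullback would not be invertible at `x`. -/
theorem oddBody_eval_pullbackOn (c : SuperChart X m n) {k l : ℕ} (d : SuperChart Y k l) (φ : X ⟶ Y)
    {U : Opens Y.space} {V : Opens X.space} (h : V ≤ Superspace.Hom.preimage φ U)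
    (hV : V ≤ c.source) (hU : U ≤ d.source) (f : Y.sections U) (x : V) :
    oddBody n (c.eval hV x (Superspace.Hom.pullbackOn φ h f)) =
      oddBody l (d.eval hU ⟨Superspace.Hom.base φ x, h x.2⟩ f) := by
  by_contra hne
  set a := oddBody n (c.eval hV x (Superspace.Hom.pullbackOn φ h f)) with ha
  let O : Opens Y.space := ⟨Subtype.val '' {y : U | oddBody l (d.eval hU y f) ≠ a},
    U.2.isOpenMap_subtype_val _ (isOpen_ne_fun (d.continuous_oddBody_eval hU f) continuous_const)⟩
  have hOU : O ≤ U := by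
    rintro _ ⟨y, -, rfl⟩
    exact y.2
  have hunit : IsUnit (Y.res hOU f - algebraMap ℂ _ a) := by
    refine d.isUnit_of_oddBody_eval_ne_zero (hOU.trans hU) ?_
    rintro ⟨_, y, hy, rfl⟩
    rw [map_sub, map_sub, AlgHom.commutes, AlgHom.commutes, d.eval_res hOU hU]
    exact sub_ne_zero.2 hy
  let V' : Opens X.space := V ⊓ Superspace.Hom.preimage φ O
  have hx' : (x : X.space) ∈ V' := ⟨x.2, ⟨⟨_, h x.2⟩, fun e => hne e.symm, rfl⟩⟩
  have hunit' := ((hunit.map (Superspace.Hom.pullbackOn φ (inf_le_right : V' ≤ _))).map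
    (c.eval (inf_le_left.trans hV) ⟨x, hx'⟩)).map (oddBody n)
  have hres : Superspace.Hom.pullbackOn φ (inf_le_right : V' ≤ _) (Y.res hOU f) =
      X.res inf_le_left (Superspace.Hom.pullbackOn φ h f) := by
    rw [Superspace.pullbackOn_res, Superspace.res_pullbackOn]
  rw [map_sub, map_sub, map_sub, hres, AlgHom.commutes, AlgHom.commutes, AlgHom.commutes,
    c.eval_res inf_le_left hV] at hunit'
  simp [ha] at hunit'

end SuperChart

/-! ### Coordinate sections, and morphisms in a superchart -/

namespace SuperChart

variable {X : Superspace.{u}} {m n : ℕ}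

/-- The even coordinate `z_i` of a superchart, as a section over its domain. -/
noncomputable def evenSection (c : SuperChart X m n) (i : Fin m) : X.sections c.source :=
  (c.iso c.source subset_rfl).symm (evenCoord n _ i)

/-- The odd coordinate `ξ_j` of a superchart, as a section over its domain. -/
noncomputable def oddSection (c : SuperChart X m n) (j : Fin n) : X.sections c.source :=
  (c.iso c.source subset_rfl).symm (oddCoord m _ j)

theorem iso_res_evenSection (c : SuperChart X m n) {V : Opens X.space} (hV : V ≤ c.source)
    (i : Fin m) : c.iso V hV (X.res hV (c.evenSection i)) = evenCoord n _ i := by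
  rw [c.iso_res hV subset_rfl, evenSection, AlgEquiv.apply_symm_apply]
  rfl

theorem iso_res_oddSection (c : SuperChart X m n) {V : Opens X.space} (hV : V ≤ c.source)
    (j : Fin n) : c.iso V hV (X.res hV (c.oddSection j)) = oddCoord m _ j := by
  rw [c.iso_res hV subset_rfl, oddSection, AlgEquiv.apply_symm_apply]
  rfl

theorem eval_evenSection (c : SuperChart X m n) (i : Fin m) (x : c.source) :
    c.eval le_rfl x (c.evenSection i) = algebraMap ℂ _ (c.homeo x i) := by
  change ((c.iso c.source subset_rfl) ((c.iso c.source subset_rfl).symm _)).1 _ = _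
  rw [AlgEquiv.apply_symm_apply]
  rfl

theorem eval_oddSection (c : SuperChart X m n) (j : Fin n) (x : c.source) :
    c.eval le_rfl x (c.oddSection j) = oddGen n j := by
  change ((c.iso c.source subset_rfl) ((c.iso c.source subset_rfl).symm _)).1 _ = _
  rw [AlgEquiv.apply_symm_apply]
  rfl

/-- In coordinates, the map underlying a morphism is holomorphic: its components are the bodies of
the pullbacks of the even coordinates. -/
theorem differentiableOn_base (c : SuperChart X m n) (φ : X ⟶ X) {W : Opens X.space}
    (hW : W ≤ c.source) (h : W ≤ Superspace.Hom.preimage φ c.source) :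
    DifferentiableOn ℂ (fun z => c.homeo (Superspace.Hom.base φ (c.homeo.symm z)))
      (imageOpens c.homeo W hW : Set (Fin m → ℂ)) := by
  refine differentiableOn_pi.2 fun i => ?_
  refine ((c.iso W hW (Superspace.Hom.pullbackOn φ h (c.evenSection i))).2 ∅).congr ?_
  rintro _ ⟨x, hx, rfl⟩
  have h1 := c.oddBody_eval_pullbackOn c φ h hW le_rfl (c.evenSection i) ⟨x, hx⟩
  rw [eval_evenSection, AlgHom.commutes] at h1
  rw [IsHolomorphicFun.extend_apply (U := imageOpens c.homeo W hW) _ ⟨c.homeo x, x, hx, rfl⟩,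
    oddMonomials_repr_empty, c.homeo.left_inv (hW hx)]
  exact h1.symm

/-- An endomorphism of the algebra of sections over an open subset of the domain of a superchart,
written in coordinates. -/
noncomputable def conj (c : SuperChart X m n) {W : Opens X.space} (hW : W ≤ c.source)
    (T : X.sections W →ₐ[ℂ] X.sections W) :
    superFunctions m n (imageOpens c.homeo W hW) →ₐ[ℂ]
      superFunctions m n (imageOpens c.homeo W hW) :=
  ((c.iso W hW).toAlgHom.comp T).comp (c.iso W hW).symm.toAlgHom

theorem conj_apply_iso (c : SuperChart X m n) {W : Opens X.space} (hW : W ≤ c.source)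
    (T : X.sections W →ₐ[ℂ] X.sections W) (f : X.sections W) :
    c.conj hW T (c.iso W hW f) = c.iso W hW (T f) :=
  congrArg (fun g => c.iso W hW (T g)) ((c.iso W hW).symm_apply_apply f)

theorem conj_pow_apply_iso (c : SuperChart X m n) {W : Opens X.space} (hW : W ≤ c.source)
    (T : X.sections W →ₐ[ℂ] X.sections W) (s : ℕ) (f : X.sections W) :
    (c.conj hW T ^ s) (c.iso W hW f) = c.iso W hW ((T ^ s) f) := by
  induction s with
  | zero => rfl
  | succ s ih => rw [pow_succ', pow_succ', AlgHom.mul_apply, AlgHom.mul_apply, ih, conj_apply_iso]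

theorem oddBody_conj_pullbackOn (c : SuperChart X m n) {φ : X ⟶ X} {W : Opens X.space}
    (hW : W ≤ c.source) (hfix : ∀ x ∈ W, Superspace.Hom.base φ x = x)
    (h : W ≤ Superspace.Hom.preimage φ W) (f : superFunctions m n (imageOpens c.homeo W hW))
    (z : imageOpens c.homeo W hW) :
    oddBody n ((c.conj hW (Superspace.Hom.pullbackOn φ h) f).1 z) = oddBody n (f.1 z) := by
  obtain ⟨g, rfl⟩ := (c.iso W hW).surjective f
  obtain ⟨_, x, hx, rfl⟩ := z
  rw [conj_apply_iso]
  refine (c.oddBody_eval_pullbackOn c φ h hW hW g ⟨x, hx⟩).trans ?_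
  have hx' : (⟨Superspace.Hom.base φ x, h hx⟩ : W) = ⟨x, hx⟩ := Subtype.ext (hfix x hx)
  exact congrArg (fun y : W => oddBody n (c.eval hW y g)) hx'

/-- A morphism that fixes the points and the coordinates of a superchart on `L` is trivial on the
sections near `L`. -/
theorem pullbackOn_eq_res_of_fixes_coord (c : SuperChart X m n) {φ : X ⟶ X} {L : Opens X.space}
    (hL : L ≤ c.source) (hfix : ∀ x ∈ L, Superspace.Hom.base φ x = x)
    (hpre : L ≤ Superspace.Hom.preimage φ c.source)
    (hev : ∀ i, Superspace.Hom.pullbackOn φ hpre (c.evenSection i) = X.res hL (c.evenSection i))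
    (hodd : ∀ j, Superspace.Hom.pullbackOn φ hpre (c.oddSection j) = X.res hL (c.oddSection j))
    {U V : Opens X.space} (h : V ≤ Superspace.Hom.preimage φ U) (h' : V ≤ U) (hV : V ≤ L)
    (f : X.sections U) : Superspace.Hom.pullbackOn φ h f = X.res h' f := by
  refine c.eq_of_eval_eq (hV.trans hL) ?_
  rintro ⟨x, hx⟩
  have hVc := hV.trans hL
  obtain ⟨r, hr, hball⟩ := Metric.isOpen_iff.1 (imageOpens c.homeo V hVc).2 (c.homeo x)
    ⟨x, hx, rfl⟩
  -- the part `D` of `V` corresponding to a polydisc around `x`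
  let D : Opens X.space := ⟨c.homeo.source ∩ c.homeo ⁻¹' Metric.ball (c.homeo x) r,
    c.homeo.isOpen_inter_preimage Metric.isOpen_ball⟩
  have hDc : D ≤ c.source := fun y hy => hy.1
  have hDV : D ≤ V := by
    rintro y ⟨hy, hyr⟩
    obtain ⟨y', hy', e⟩ := hball hyr
    exact c.homeo.injOn (hVc hy') hy e ▸ hy'
  have hxD : x ∈ D := ⟨hVc hx, Metric.mem_ball_self hr⟩
  have himage : (imageOpens c.homeo D hDc : Set (Fin m → ℂ)) = Metric.ball (c.homeo x) r := by
    refine subset_antisymm ?_ fun z hz => ?_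
    · rintro _ ⟨y, hy, rfl⟩
      exact hy.2
    · obtain ⟨y, hy, rfl⟩ := hball hz
      exact ⟨y, ⟨hVc hy, hz⟩, rfl⟩
  have hDfix : ∀ y ∈ D, Superspace.Hom.base φ y = y := fun y hy => hfix y (hV (hDV hy))
  have hDpre : D ≤ Superspace.Hom.preimage φ D := fun y hy => by
    rw [Superspace.Hom.mem_preimage, hDfix y hy]
    exact hy
  have hcoord : ∀ s : X.sections c.source,
      Superspace.Hom.pullbackOn φ hpre s = X.res hL s →
      Superspace.Hom.pullbackOn φ hDpre (X.res hDc s) = X.res hDc s := fun s hs => by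
    have := congrArg (X.res (hDV.trans hV)) hs
    rw [Superspace.res_pullbackOn, Superspace.res_res] at this
    rw [Superspace.pullbackOn_res]
    exact this
  have key := apply_apply_center (τ := c.conj hDc (Superspace.Hom.pullbackOn φ hDpre))
    (fun i => by
      rw [← c.iso_res_evenSection hDc, conj_apply_iso, hcoord _ (hev i)])
    (fun j => by
      rw [← c.iso_res_oddSection hDc, conj_apply_iso, hcoord _ (hodd j)])
    himage ⟨x, hxD, rfl⟩ (c.iso D hDc (X.res (hDV.trans h') f))
  rw [conj_apply_iso, Superspace.pullbackOn_res] at key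
  have e1 := c.eval_res hDV hVc (Superspace.Hom.pullbackOn φ h f) ⟨x, hxD⟩
  have e2 := c.eval_res hDV hVc (X.res h' f) ⟨x, hxD⟩
  rw [Superspace.res_pullbackOn] at e1
  rw [Superspace.res_res] at e2
  exact e1.symm.trans (key.trans e2)

end SuperChart

/-! ### Groups of automorphisms close to the identity -/

namespace ComplexSupermanifold

variable {m n : ℕ} {M : ComplexSupermanifold.{u} m n}

theorem AutZero.base_mul (φ ψ : M.AutZero) (x : M.toSuperspace.space) :
    Superspace.Hom.base (φ * ψ).toMorphism x =
      Superspace.Hom.base φ.toMorphism (Superspace.Hom.base ψ.toMorphism x) := rfl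

theorem AutZero.ext_toMorphism {φ ψ : M.AutZero} (h : φ.toMorphism = ψ.toMorphism) : φ = ψ :=
  Iso.ext h

theorem AutZero.base_pow_eq_self {φ : M.AutZero} {x : M.toSuperspace.space}
    (h : Superspace.Hom.base φ.toMorphism x = x) (s : ℕ) :
    Superspace.Hom.base (φ ^ s).toMorphism x = x := by
  induction s with
  | zero => rw [pow_zero]; rfl
  | succ s ih => rw [pow_succ, AutZero.base_mul, h, ih]

theorem AutZero.pullbackOn_pow {φ : M.AutZero} {U : Opens M.toSuperspace.space}
    (h : U ≤ Superspace.Hom.preimage φ.toMorphism U) (s : ℕ)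
    (hs : U ≤ Superspace.Hom.preimage (φ ^ s).toMorphism U) :
    Superspace.Hom.pullbackOn (φ ^ s).toMorphism hs =
      Superspace.Hom.pullbackOn φ.toMorphism h ^ s := by
  have hpre : ∀ s : ℕ, U ≤ Superspace.Hom.preimage (φ ^ s).toMorphism U := by
    intro s
    induction s with
    | zero => rw [pow_zero]; exact fun x hx => hx
    | succ s ih => rw [pow_succ]; exact fun x hx => ih (h hx)
  induction s with
  | zero => exact AlgHom.ext fun f => Superspace.res_self f
  | succ s ih =>
    refine AlgHom.ext fun f => ?_
    have key : ∀ (ψ : M.AutZero) (hψ : U ≤ Superspace.Hom.preimage ψ.toMorphism U),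
        ψ = φ ^ s * φ → Superspace.Hom.pullbackOn ψ.toMorphism hψ f =
          Superspace.Hom.pullbackOn φ.toMorphism h
            (Superspace.Hom.pullbackOn (φ ^ s).toMorphism (hpre s) f) := by
      rintro _ hψ rfl
      exact Superspace.pullbackOn_comp φ.toMorphism (φ ^ s).toMorphism (hpre s) h hψ f
    rw [key _ hs (pow_succ φ s), ih (hpre s), pow_succ' (Superspace.Hom.pullbackOn _ h),
      AlgHom.mul_apply]

theorem subbasicSet_mem_nhds_one (c : SuperChart M.toSuperspace m n)
    {K : Set M.toSuperspace.space} (hK : IsCompact K) (hKc : K ⊆ c.source)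
    {U : Opens M.toSuperspace.space} (hKU : K ⊆ U) (f : M.toSuperspace.sections U)
    {O : Finset (Fin n) → Set ℂ} (hO : ∀ ν, IsOpen (O ν))
    (hf : ∀ (ν) (x : (U ⊓ c.source : Opens M.toSuperspace.space)),
      (x : M.toSuperspace.space) ∈ K → (oddMonomials n).repr
        (c.eval inf_le_right x (M.toSuperspace.res inf_le_left f)) ν ∈ O ν) :
    M.subbasicSet c K U f O ∈ nhds (1 : M.AutZero) := by
  refine IsOpen.mem_nhds (isOpen_generateFrom_of_mem ⟨c, K, U, f, O, hK, hKc, hO, rfl⟩) ?_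
  exact ⟨fun x hx => hKU hx, fun ν x hx => hf ν x hx⟩

theorem AutZero.coeff_localPullback (φ : M.AutZero) (c : SuperChart M.toSuperspace m n)
    {U W : Opens M.toSuperspace.space} (f : M.toSuperspace.sections U) (hW : W ≤ c.source)
    (h : W ≤ Superspace.Hom.preimage φ.toMorphism U) (ν : Finset (Fin n)) (x : W) :
    c.coeff inf_le_right (φ.localPullback c f) ν ⟨x, h x.2, hW x.2⟩ =
      (oddMonomials n).repr (c.eval hW x (Superspace.Hom.pullbackOn φ.toMorphism h f)) ν := by
  have := c.eval_res (le_inf h hW) inf_le_right (φ.localPullback c f) x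
  rw [SuperChart.coeff_eq, ← this]
  congr 3
  exact Superspace.res_res _ _ _

/-- An automorphism that fixes the points of `L` is trivial on the sections near `L` if all its powers
keep the pullbacks of the coordinates close to the coordinates. The body of an even coordinate,
which is fixed anyway, is left unrestricted. -/
theorem AutZero.pullbackOn_eq_res_of_pow_mem {φ : M.AutZero} (c : SuperChart M.toSuperspace m n)
    {K : Set M.toSuperspace.space} {L : Opens M.toSuperspace.space} (hL : L ≤ c.source)
    (hLK : (L : Set M.toSuperspace.space) ⊆ K)
    (hfix : ∀ x ∈ L, Superspace.Hom.base φ.toMorphism x = x)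
    (hodd : ∀ (s : ℕ) (j : Fin n), φ ^ s ∈ M.subbasicSet c K c.source (c.oddSection j) fun ν =>
      Metric.ball ((oddMonomials n).repr (oddGen n j) ν) (1 / (2 * (n + 1))))
    (heven : ∀ (s : ℕ) (i : Fin m), φ ^ s ∈ M.subbasicSet c K c.source (c.evenSection i) fun ν =>
      if ν = ∅ then Set.univ else Metric.ball 0 1)
    {U V : Opens M.toSuperspace.space} (h : V ≤ Superspace.Hom.preimage φ.toMorphism U)
    (h' : V ≤ U) (hV : V ≤ L) (f : M.toSuperspace.sections U) :
    Superspace.Hom.pullbackOn φ.toMorphism h f = M.toSuperspace.res h' f := by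
  have hfix' : ∀ (s : ℕ), ∀ x ∈ L, Superspace.Hom.base (φ ^ s).toMorphism x = x :=
    fun s x hx => AutZero.base_pow_eq_self (hfix x hx) s
  have hLL : ∀ s : ℕ, L ≤ Superspace.Hom.preimage (φ ^ s).toMorphism L := fun s x hx => by
    rw [Superspace.Hom.mem_preimage, hfix' s x hx]
    exact hx
  have hLc : ∀ s : ℕ, L ≤ Superspace.Hom.preimage (φ ^ s).toMorphism c.source :=
    fun s x hx => hL (hLL s hx)
  have hT : L ≤ Superspace.Hom.preimage φ.toMorphism L := pow_one φ ▸ hLL 1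
  have hTc : L ≤ Superspace.Hom.preimage φ.toMorphism c.source := fun x hx => hL (hT hx)
  let τ := c.conj hL (Superspace.Hom.pullbackOn φ.toMorphism hT)
  -- the powers of `τ` on coordinates are the coefficients controlled by the hypotheses
  have hpow : ∀ (s : ℕ) (g : M.toSuperspace.sections c.source) (ν : Finset (Fin n)) (x : L),
      (oddMonomials n).repr (((τ ^ s) (c.iso L hL (M.toSuperspace.res hL g))).1
        ⟨c.homeo x, x, x.2, rfl⟩) ν =
      c.coeff inf_le_right ((φ ^ s).localPullback c g) ν ⟨x, hLc s x.2, hL x.2⟩ := by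
    intro s g ν x
    rw [AutZero.coeff_localPullback (φ ^ s) c g hL (hLc s) ν x, SuperChart.conj_pow_apply_iso,
      ← AutZero.pullbackOn_pow hT s (hLL s), Superspace.pullbackOn_res]
    rfl
  obtain ⟨h1, h2⟩ := apply_coord_eq_self (τ := τ)
    (fun f z => c.oddBody_conj_pullbackOn hL hfix hT f z)
    (by
      rintro s j ⟨_, x, hx, rfl⟩ ν
      rw [← c.iso_res_oddSection hL j, hpow s _ ν ⟨x, hx⟩, ← dist_eq_norm]
      exact (Metric.mem_ball.1 ((hodd s j).2 ν _ (hLK hx))).le)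
    (by
      rintro s i ⟨_, x, hx, rfl⟩ ν hν
      rw [← c.iso_res_evenSection hL i, hpow s _ ν ⟨x, hx⟩, ← dist_zero_right]
      have := (heven s i).2 ν ⟨x, hLc s hx, hL hx⟩ (hLK hx)
      simp only [if_neg hν] at this
      exact (Metric.mem_ball.1 this).le)
  have hsec : ∀ g : M.toSuperspace.sections c.source,
      τ (c.iso L hL (M.toSuperspace.res hL g)) = c.iso L hL (M.toSuperspace.res hL g) →
      Superspace.Hom.pullbackOn φ.toMorphism hTc g = M.toSuperspace.res hL g := by
    intro g hg
    rw [c.conj_apply_iso, Superspace.pullbackOn_res] at hg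
    exact (c.iso L hL).injective hg
  exact c.pullbackOn_eq_res_of_fixes_coord hL hfix hTc
    (fun i => hsec _ (by rw [c.iso_res_evenSection]; exact h1 i))
    (fun j => hsec _ (by rw [c.iso_res_oddSection]; exact h2 j)) h h' hV f

/-- Automorphisms close to the identity are uniformly close to the identity, in coordinates, on a
compact subset of the domain of a superchart. -/
theorem eventually_nhds_one_dist_le (c : SuperChart M.toSuperspace m n)
    {K : Set M.toSuperspace.space} (hK : IsCompact K) (hKc : K ⊆ c.source) {ε : ℝ} (hε : 0 < ε) :
    ∀ᶠ φ in nhds (1 : M.AutZero), ∀ x ∈ K, Superspace.Hom.base φ.toMorphism x ∈ c.source ∧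
      dist (c.homeo (Superspace.Hom.base φ.toMorphism x)) (c.homeo x) ≤ ε := by
  refine hK.induction_on (p := fun S => ∀ᶠ φ in nhds (1 : M.AutZero), ∀ x ∈ S,
    Superspace.Hom.base φ.toMorphism x ∈ c.source ∧
      dist (c.homeo (Superspace.Hom.base φ.toMorphism x)) (c.homeo x) ≤ ε)
    ?_ ?_ ?_ ?_
  · exact Filter.Eventually.of_forall fun φ x hx => absurd hx (Set.notMem_empty x)
  · intro S T hST hT
    filter_upwards [hT] with φ h x hx using h x (hST hx)
  · intro S T hS hT
    filter_upwards [hS, hT] with φ h h' x hx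
    rcases hx with hx | hx
    exacts [h x hx, h' x hx]
  intro x hx
  obtain ⟨δ, hδ, hδc⟩ := Metric.nhds_basis_closedBall.mem_iff.1
    (c.homeo.open_target.mem_nhds (c.homeo.map_source (hKc hx)))
  let ρ := min δ (ε / 3)
  have hρ : 0 < ρ := lt_min hδ (by positivity)
  have hρc : Metric.closedBall (c.homeo x) ρ ⊆ c.homeo.target :=
    (Metric.closedBall_subset_closedBall (min_le_left _ _)).trans hδc
  have hρε : ρ ≤ ε / 3 := min_le_right _ _
  let U : Opens M.toSuperspace.space :=
    ⟨c.homeo.source ∩ c.homeo ⁻¹' Metric.ball (c.homeo x) (ε / 2),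
      c.homeo.isOpen_inter_preimage Metric.isOpen_ball⟩
  have hS : ∀ y ∈ c.homeo.symm '' Metric.closedBall (c.homeo x) ρ,
      y ∈ c.source ∧ dist (c.homeo y) (c.homeo x) ≤ ρ := by
    rintro _ ⟨z, hz, rfl⟩
    refine ⟨c.homeo.map_target (hρc hz), ?_⟩
    rw [c.homeo.right_inv (hρc hz)]
    exact hz
  refine ⟨c.homeo.symm '' Metric.closedBall (c.homeo x) ρ, mem_nhdsWithin_of_mem_nhds ?_, ?_⟩
  · have := c.homeo.symm.image_mem_nhds (c.homeo.map_source (hKc hx))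
      (Metric.closedBall_mem_nhds (c.homeo x) hρ)
    rwa [c.homeo.left_inv (hKc hx)] at this
  · -- the section `0` and the sets `O ν = ℂ` leave only the condition on `φ̃`
    have hmem := subbasicSet_mem_nhds_one c
      ((isCompact_closedBall (c.homeo x) ρ).image_of_continuousOn
        (c.homeo.symm.continuousOn.mono hρc)) (fun y hy => (hS y hy).1) (U := U)
      (fun y hy => ⟨(hS y hy).1, Metric.mem_ball.2 (by linarith [(hS y hy).2])⟩) 0
      (O := fun _ => Set.univ) (fun _ => isOpen_univ) fun _ _ _ => Set.mem_univ _
    filter_upwards [hmem] with φ hφ y hy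
    have h1 := hφ.1 hy
    have h2 := Metric.mem_ball.1 h1.2
    refine ⟨h1.1, (dist_triangle_right _ _ (c.homeo x)).trans ?_⟩
    linarith [(hS y hy).2]

/-- A submonoid of automorphisms all of which, in a superchart, move the points of a ball by little fixes
the points of the concentric ball of half the radius: the displacement of a point grows
geometrically under iterated squaring. -/
theorem AutZero.base_eq_self_of_forall_dist_le (c : SuperChart M.toSuperspace m n)
    {p : Fin m → ℂ} {r : ℝ} (hball : Metric.closedBall p (2 * r) ⊆ c.homeo.target)
    (Q : Submonoid M.AutZero)
    (hQ : ∀ φ ∈ Q, ∀ x ∈ c.source, c.homeo x ∈ Metric.closedBall p (2 * r) →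
      Superspace.Hom.base φ.toMorphism x ∈ c.source ∧
        dist (c.homeo (Superspace.Hom.base φ.toMorphism x)) (c.homeo x) ≤ r / 4)
    {φ : M.AutZero} (hφ : φ ∈ Q) {x : M.toSuperspace.space} (hx : x ∈ c.source)
    (hxr : c.homeo x ∈ Metric.ball p r) : Superspace.Hom.base φ.toMorphism x = x := by
  have hr : 0 < r := dist_nonneg.trans_lt hxr
  have hxr2 : c.homeo x ∈ Metric.closedBall p (2 * r) :=
    Metric.mem_closedBall.2 (by linarith [Metric.mem_ball.1 hxr])
  let W : Opens M.toSuperspace.space := ⟨c.homeo.source ∩ c.homeo ⁻¹' Metric.ball p (2 * r),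
    c.homeo.isOpen_inter_preimage Metric.isOpen_ball⟩
  have hWc : W ≤ c.source := fun y hy => hy.1
  have himage : Metric.ball p (2 * r) ⊆ (imageOpens c.homeo W hWc : Set (Fin m → ℂ)) := by
    intro z hz
    have hzt := hball (Metric.ball_subset_closedBall hz)
    exact ⟨c.homeo.symm z, ⟨c.homeo.map_target hzt, by
      rw [Set.mem_preimage, c.homeo.right_inv hzt]; exact hz⟩, c.homeo.right_inv hzt⟩
  have key : ∀ ψ ∈ Q, 3 / 2 * dist (c.homeo (Superspace.Hom.base ψ.toMorphism x)) (c.homeo x) ≤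
      dist (c.homeo (Superspace.Hom.base (ψ * ψ).toMorphism x)) (c.homeo x) := by
    intro ψ hψ
    have hdiff := c.differentiableOn_base ψ.toMorphism hWc fun y hy =>
      (hQ ψ hψ y hy.1 (Metric.ball_subset_closedBall hy.2)).1
    have := norm_apply_apply_sub_self_ge (hdiff.mono himage) (fun z hz => by
      have hzt := hball (Metric.ball_subset_closedBall hz)
      have h := (hQ ψ hψ (c.homeo.symm z) (c.homeo.map_target hzt) (by
        rw [c.homeo.right_inv hzt]
        exact Metric.ball_subset_closedBall hz)).2
      rwa [c.homeo.right_inv hzt, dist_eq_norm] at h) hxr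
    simp only [c.homeo.left_inv hx, c.homeo.left_inv (hQ ψ hψ x hx hxr2).1] at this
    rw [AutZero.base_mul, dist_eq_norm, dist_eq_norm]
    exact this
  have hpow : ∀ k : ℕ, φ ^ k ∈ Q := fun k => pow_mem hφ k
  have h0 := eq_zero_of_geometric_growth
    (d := fun k => dist (c.homeo (Superspace.Hom.base (φ ^ 2 ^ k).toMorphism x)) (c.homeo x))
    (C := r / 4) dist_nonneg (fun k => by
      simp only [pow_succ 2 k, pow_mul φ, pow_two]
      exact key _ (hpow _)) fun k => (hQ _ (hpow _) x hx hxr2).2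
  rw [pow_zero, pow_one, dist_eq_zero] at h0
  exact c.homeo.injOn (hQ φ hφ x hx hxr2).1 hx h0

/-- Near every point, all elements of a small group of automorphisms are trivial. -/
theorem exists_nhds_one_forall_trivial_near (p : M.toSuperspace.space) :
    ∃ (L : Opens M.toSuperspace.space), p ∈ L ∧ ∃ Ω ∈ nhds (1 : M.AutZero),
      ∀ Q : Subgroup M.AutZero, (Q : Set M.AutZero) ⊆ Ω → ∀ φ ∈ Q,
        (∀ x ∈ L, Superspace.Hom.base φ.toMorphism x = x) ∧
        ∀ {U V : Opens M.toSuperspace.space} (h : V ≤ Superspace.Hom.preimage φ.toMorphism U)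
          (h' : V ≤ U), V ≤ L → ∀ f : M.toSuperspace.sections U,
            Superspace.Hom.pullbackOn φ.toMorphism h f = M.toSuperspace.res h' f := by
  obtain ⟨c, hp⟩ := M.exists_chart p
  obtain ⟨δ, hδ, hδc⟩ := Metric.nhds_basis_closedBall.mem_iff.1
    (c.homeo.open_target.mem_nhds (c.homeo.map_source hp))
  obtain ⟨r, hr, hball⟩ : ∃ r > 0, Metric.closedBall (c.homeo p) (2 * r) ⊆ c.homeo.target :=
    ⟨δ / 2, half_pos hδ, by rwa [mul_div_cancel₀ δ two_ne_zero]⟩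
  set K := c.homeo.symm '' Metric.closedBall (c.homeo p) (2 * r)
  have hK : IsCompact K := (isCompact_closedBall (c.homeo p) _).image_of_continuousOn
    (c.homeo.symm.continuousOn.mono hball)
  have hKc : K ⊆ c.source := by
    rintro _ ⟨z, hz, rfl⟩
    exact c.homeo.map_target (hball hz)
  have hmemK : ∀ x ∈ c.source, c.homeo x ∈ Metric.closedBall (c.homeo p) (2 * r) → x ∈ K :=
    fun x hx hxr => ⟨c.homeo x, hxr, c.homeo.left_inv hx⟩
  let L : Opens M.toSuperspace.space := ⟨c.homeo.source ∩ c.homeo ⁻¹' Metric.ball (c.homeo p) r,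
    c.homeo.isOpen_inter_preimage Metric.isOpen_ball⟩
  have hLc : L ≤ c.source := fun x hx => hx.1
  have hLK : (L : Set M.toSuperspace.space) ⊆ K := fun x hx => hmemK x hx.1
    (Metric.mem_closedBall.2 (by linarith [Metric.mem_ball.1 hx.2]))
  let Oodd : Fin n → Finset (Fin n) → Set ℂ := fun j ν =>
    Metric.ball ((oddMonomials n).repr (oddGen n j) ν) (1 / (2 * (n + 1)))
  let Oev : Finset (Fin n) → Set ℂ := fun ν => if ν = ∅ then Set.univ else Metric.ball 0 1
  have h1 := eventually_nhds_one_dist_le c hK hKc (by positivity : 0 < r / 4)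
  have h2 : ∀ j, M.subbasicSet c K c.source (c.oddSection j) (Oodd j) ∈ nhds (1 : M.AutZero) :=
    fun j => subbasicSet_mem_nhds_one c hK hKc hKc _ (fun ν => Metric.isOpen_ball)
      fun ν x _ => by
        rw [c.eval_res inf_le_left le_rfl, c.eval_oddSection]
        exact Metric.mem_ball_self (by positivity)
  have h3 : ∀ i, M.subbasicSet c K c.source (c.evenSection i) Oev ∈ nhds (1 : M.AutZero) :=
    fun i => subbasicSet_mem_nhds_one c hK hKc hKc _
      (fun ν => by
        simp only [Oev]
        split_ifs
        exacts [isOpen_univ, Metric.isOpen_ball])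
      fun ν x _ => by
        simp only [Oev]
        split_ifs with hν
        · exact Set.mem_univ _
        · rw [c.eval_res inf_le_left le_rfl, c.eval_evenSection, Algebra.algebraMap_eq_smul_one,
            ← oddMonomials_empty, map_smul, Module.Basis.repr_self, Finsupp.smul_apply,
            Finsupp.single_eq_of_ne hν, smul_zero]
          exact Metric.mem_ball_self one_pos
  refine ⟨L, ⟨hp, Metric.mem_ball_self hr⟩, _, Filter.inter_mem h1 (Filter.inter_mem
    (Filter.iInter_mem.2 h2) (Filter.iInter_mem.2 h3)), fun Q hQ φ hφ => ?_⟩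
  have hfix : ∀ x ∈ L, Superspace.Hom.base φ.toMorphism x = x := fun x hx =>
    AutZero.base_eq_self_of_forall_dist_le c hball Q.toSubmonoid
      (fun ψ hψ y hy hyr => (hQ hψ).1 y (hmemK y hy hyr)) hφ hx.1 hx.2
  exact ⟨hfix, fun h h' hV f => AutZero.pullbackOn_eq_res_of_pow_mem c hLc hLK hfix
    (fun s j => Set.mem_iInter.1 (hQ (pow_mem hφ s)).2.1 j)
    (fun s i => Set.mem_iInter.1 (hQ (pow_mem hφ s)).2.2 i) h h' hV f⟩

end ComplexSupermanifold

theorem mainTheorem6 {m n : ℕ} (M : ComplexSupermanifold.{u} m n)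
    (hM : M.IsCompactSupermanifold) :
    ∃ Ω ∈ nhds (1 : M.AutZero), ∀ Q : Subgroup M.AutZero, (Q : Set M.AutZero) ⊆ Ω → Q = ⊥ := by
  have : CompactSpace M.toSuperspace.space := hM
  choose L hpL Ω hΩ h using M.exists_nhds_one_forall_trivial_near
  obtain ⟨t, ht⟩ := isCompact_univ.elim_finite_subcover (fun p => (L p : Set M.toSuperspace.space))
    (fun p => (L p).2) fun p _ => Set.mem_iUnion.2 ⟨p, hpL p⟩
  refine ⟨⋂ p ∈ t, Ω p, (Filter.biInter_finset_mem t).2 fun p _ => hΩ p, fun Q hQ => ?_⟩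
  have hcover : ∀ x, ∃ p ∈ t, x ∈ L p := fun x => by simpa using ht (Set.mem_univ x)
  have hQp : ∀ p ∈ t, (Q : Set M.AutZero) ⊆ Ω p := fun p hp =>
    hQ.trans (Set.biInter_subset_of_mem hp)
  refine (Subgroup.eq_bot_iff_forall Q).2 fun φ hφ => ?_
  refine ComplexSupermanifold.AutZero.ext_toMorphism
    (Superspace.eq_id_of_pullbackOn_eq_res (fun x => ?_) fun {U V} hV hV' f => ?_)
  · obtain ⟨p, hp, hx⟩ := hcover x
    exact (h p Q (hQp p hp) φ hφ).1 x hx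
  · refine Superspace.sections_ext fun x hx => ?_
    obtain ⟨p, hp, hxp⟩ := hcover x
    refine ⟨V ⊓ L p, inf_le_left, ⟨hx, hxp⟩, ?_⟩
    rw [Superspace.res_pullbackOn, Superspace.res_res]
    exact (h p Q (hQp p hp) φ hφ).2 _ _ inf_le_right f
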